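/- **Setting.** There are $N$ agents; agent $i$ is a Markov decision process with finite state set $\mathcal S^i$, initial state $s_I^i$, finite action set $\mathcal A^i$ and transition probabilities $\mathcal T^i(s^i,a^i,\cdot)$. Put $\mathcal S=\prod_i\mathcal S^i$, $\mathcal A=\prod_i\mathcal A^i$, $s_I=(s_I^i)_i$; the agents move independently given the joint action, i.e. $\mathcal T(s,a,y)=\prod_i\mathcal T^i(s^i,a^i,y^i)$. Let $\pi:\mathcal S\to\Delta(\mathcal A)$ be a stationary joint policy, and let $\mathcal S_T,\mathcal S_A\subseteq\mathcal S$ be sets of target states and of states to avoid. A joint path $s_0a_0s_1a_1\ldots$ is *successful* if there is $m\ge 0$ with $s_m\in\mathcal S_T$ and $s_t\notin\mathcal S_A$ for all $t<m$. *Full communication:* $s_0=s_I$, $a_t\sim\pi(s_t)$, $s_{t+1}\sim\mathcal T(s_t,a_t)$. Let $X$ be the resulting random joint path, $X^i=s_0^ia_0^is_1^ia_1^i\ldots$ the path of agent $i$, $v^{full}$ the probability of success, $\mathcal S_D$ the set of joint states from which (under full communication, started there) the probability of success is $0$, and $l^{full}=\mathbb E\big[\min\{t+1: s_t\in\mathcal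 S_T\cup\mathcal S_D\}\big]$. *Total correlation:* $C_\pi\in[0,\infty]$ is the Kullback–Leibler divergence of the joint law of $(X^1,\ldots,X^N)$ from the product of the laws of $X^1,\ldots,X^N$. *Intermittent communication with dropout rate $q\in[0,1]$:* at every time $t$, independently of everything before, communication is available with probability $1-q$. Each agent $i$ keeps a joint state $\hat s_{t,i}\in\mathcal S$ whose $i$-th component is its true state $s_t^i$, and a joint action $\hat a_{t,i}\in\mathcal A$. If communication is available at time $t$, all agents set $\hat s_{t,i}=s_t$ (the true joint state), one joint action $a_t\sim\pi(s_t)$ is drawn, and $\hat a_{t,i}=a_t$ for all $i$. If not, each agent $i$, independently of the others, sets $\hat s_{t,i}^{\,j}=s_I^j$ if $t=0$ and draws $\hat s_{t,i}^{\,j}\sim\mathcal T^j(\hat s_{t-1,i}^{\,j},\hat a_{t-1,i}^{\,j})$ if $t\ge1$, for all $j\ne i$ independently, and then draws $\hat a_{t,i}\sim\pi(\hat s_{t,i})$. In both cases agent $i$ executes $\hat a_{t,i}^{\,i}$ and moves to $s_{t+1}^i\sim\mathcal T^i(s_t^i,\hat a_{t,i}^{\,i})$. Let $v^{int}$ be the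 probability that the true joint path is successful. **Theorem.** With $H$ the Shannon entropy in nats (equal to $\infty$ for a non-discrete distribution), $$\sum_{i=1}^N H(X^i)=C_\pi+H(X)\quad\text{in }[0,\infty],$$ so that $C_\pi=\sum_i H(X^i)-H(X)$ whenever these entropies are finite; moreover $l^{full}<\infty$, and $$v^{int}\ \ge\ \max\Big(v^{full}-\sqrt{1-\exp(-q\,C_\pi)},\ \ v^{full}\,(1-q)^{\,l^{full}/v^{full}}\Big).$$ Here $0\cdot\infty=0$ and $\exp(-\infty)=0$, and the second term of the maximum is read as $0$ if $v^{full}=0$. -/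

import Mathlib

open MeasureTheory ProbabilityTheory
open scoped ENNReal

namespace ReachAvoid

noncomputable section

/-- The law of finitely many independent draws, the `i`-th one distributed according to `p i`. -/
def piPMF {ι : Type*} [Fintype ι] [DecidableEq ι] {X : ι → Type*} [∀ i, Fintype (X i)]
    (p : ∀ i, PMF (X i)) : PMF (∀ i, X i) :=
  PMF.ofFintype (fun x => ∏ i, p i (x i)) (by
    rw [← Fintype.prod_sum]
    refine Finset.prod_eq_one fun i _ => ?_
    rw [← tsum_fintype (L := .unconditional _)]
    exact (p i).tsum_coe)

/-- The law on infinite trajectories of the time-homogeneous Markov chain with the given initial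
distribution and one-step distributions. -/
def chainLaw {Z : Type*} [Countable Z] [MeasurableSpace Z] [MeasurableSingletonClass Z]
    (init : PMF Z) (step : Z → PMF Z) : Measure (ℕ → Z) :=
  letI K : Kernel Z Z := Kernel.ofFunOfCountable fun z => (step z).toMeasure
  haveI : IsMarkovKernel K := ⟨fun z => PMF.toMeasure.isProbabilityMeasure (step z)⟩
  Kernel.trajMeasure (X := fun _ => Z) init.toMeasure fun n =>
    K.comap (fun h => h ⟨n, Finset.mem_Iic.2 le_rfl⟩) (measurable_pi_apply _)

/-- The decision process of a single agent: an initial state and the transition probabilities. -/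
structure MDP (S A : Type*) where
  init : S
  trans : S → A → PMF S

section Game

variable {ι : Type*} {S A : ι → Type*}

/-- Joint states; also used for joint actions. -/
abbrev Joint (X : ι → Type*) : Type _ := ∀ i, X i

/-- Joint paths `s₀ a₀ s₁ a₁ …`, as sequences of pairs of a joint state and a joint action. -/
abbrev JointPath (S A : ι → Type*) : Type _ := ℕ → Joint S × Joint A

/-- The path `s₀ⁱ a₀ⁱ s₁ⁱ a₁ⁱ …` of agent `i`. -/
def agentPath (i : ι) (ω : JointPath S A) : ℕ → S i × A i := fun t => ((ω t).1 i, (ω t).2 i)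

/-- The family of the paths of all agents. -/
def teamPath (ω : JointPath S A) : ∀ i, ℕ → S i × A i := fun i => agentPath i ω

/-- The joint paths that reach `T` and do not visit `Av` before. -/
def reachAvoid (T Av : Set (Joint S)) : Set (JointPath S A) :=
  {ω | ∃ m, (ω m).1 ∈ T ∧ ∀ t < m, (ω t).1 ∉ Av}

/-- `min {t + 1 | s_t ∈ E}`, which is `∞` if `E` is never visited. -/
def pathLen (E : Set (Joint S)) (ω : JointPath S A) : ℝ≥0∞ :=
  ⨅ t : ℕ, ⨅ _ : (ω t).1 ∈ E, ((t : ℝ≥0∞) + 1)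

/-- The joint initial state. -/
def initState (M : ∀ i, MDP (S i) (A i)) : Joint S := fun i => (M i).init

variable [Fintype ι] [DecidableEq ι] [∀ i, Fintype (S i)] [∀ i, Fintype (A i)]

/-- The joint transition probabilities: the agents move independently. -/
def jointTrans (M : ∀ i, MDP (S i) (A i)) (s : Joint S) (a : Joint A) : PMF (Joint S) :=
  piPMF fun i => (M i).trans (s i) (a i)

/-- The current joint state together with a joint action drawn from the policy. -/
def actFull (π : Joint S → PMF (Joint A)) (s : Joint S) : PMF (Joint S × Joint A) :=
  (π s).map fun a => (s, a)

/-- A configuration of the execution with intermittent communication at a time `t`: the flag that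
tells whether communication is available, and, for every agent `i`, the joint state `ŝ_{t,i}` and
the joint action `â_{t,i}` that agent `i` works with. The `i`-th component of `ŝ_{t,i}` is the true
state of agent `i`, and the `i`-th component of `â_{t,i}` is the action it executes. -/
abbrev Config (S A : ι → Type*) : Type _ := Bool × (ι → Joint S × Joint A)

/-- The true joint state and the executed joint action in a configuration. -/
def actual (c : Config S A) : Joint S × Joint A :=
  (fun i => (c.2 i).1 i, fun i => (c.2 i).2 i)

/-- The flag is `true` (communication is available) with probability `1 - q`, else `false`. -/
def commFlip (q : unitInterval) : PMF Bool :=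
  PMF.ofFintype (fun b => ENNReal.ofReal (if b then 1 - (q : ℝ) else q)) (by
    rw [Fintype.sum_bool, ← ENNReal.ofReal_add (by simpa using q.2.2) (by simpa using q.2.1)]
    simp)

/-- What happens at a time step when the true joint state is `s`. Communication is available with
probability `1 - q`; then the agents share `s` and jointly draw one action. Otherwise every agent
`i`, independently of the others, draws the joint state it imagines from `imagine i`, and a joint
action from the policy at this imagined joint state. -/
def act (π : Joint S → PMF (Joint A)) (q : unitInterval) (s : Joint S)
    (imagine : ι → PMF (Joint S)) : PMF (Config S A) :=
  (commFlip q).bind fun available =>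
    if available then (π s).map fun a => (true, fun _ => (s, a))
    else (piPMF fun i => (imagine i).bind (actFull π)).map fun x => (false, x)

/-- The start of the execution with intermittent communication: the joint initial state is known
to all agents. -/
def intInit (M : ∀ i, MDP (S i) (A i)) (π : Joint S → PMF (Joint A)) (q : unitInterval) :
    PMF (Config S A) :=
  act π q (initState M) fun _ => PMF.pure (initState M)

/-- One step of the execution with intermittent communication: the true states evolve under the
executed actions to `s'`, and if communication is not available then agent `i` keeps its own true
state `s' i` and simulates every teammate `j` from what it believed about `j` before. -/
def intStep (M : ∀ i, MDP (S i) (A i)) (π : Joint S → PMF (Joint A)) (q : unitInterval)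
    (c : Config S A) : PMF (Config S A) :=
  (jointTrans M (actual c).1 (actual c).2).bind fun s' =>
    act π q s' fun i => piPMF fun j =>
      if j = i then PMF.pure (s' j) else (M j).trans ((c.2 i).1 j) ((c.2 i).2 j)

variable [∀ i, MeasurableSpace (S i)] [∀ i, MeasurableSingletonClass (S i)]
  [∀ i, MeasurableSpace (A i)] [∀ i, MeasurableSingletonClass (A i)]

/-- The law of the joint path under full communication, started in the joint state `s₀`. -/
def fullLaw (M : ∀ i, MDP (S i) (A i)) (π : Joint S → PMF (Joint A)) (s₀ : Joint S) :
    Measure (JointPath S A) :=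
  chainLaw (actFull π s₀) fun z => (jointTrans M z.1 z.2).bind (actFull π)

/-- The law of the (true) joint path under intermittent communication with dropout rate `q`. -/
def intLaw (M : ∀ i, MDP (S i) (A i)) (π : Joint S → PMF (Joint A)) (q : unitInterval) :
    Measure (JointPath S A) :=
  (chainLaw (intInit M π q) (intStep M π q)).map fun c t => actual (c t)

/-- The reach-avoid probability under full communication. -/
def valueFull (M : ∀ i, MDP (S i) (A i)) (π : Joint S → PMF (Joint A)) (T Av : Set (Joint S)) : ℝ :=
  (fullLaw M π (initState M)).real (reachAvoid T Av)

/-- The reach-avoid probability under intermittent communication with dropout rate `q`. -/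
def valueInt (M : ∀ i, MDP (S i) (A i)) (π : Joint S → PMF (Joint A)) (T Av : Set (Joint S))
    (q : unitInterval) : ℝ :=
  (intLaw M π q).real (reachAvoid T Av)

/-- The dead states: those from which, under full communication, the path almost surely fails to
reach `T` while avoiding `Av`. -/
def deadStates (M : ∀ i, MDP (S i) (A i)) (π : Joint S → PMF (Joint A)) (T Av : Set (Joint S)) :
    Set (Joint S) :=
  {s | fullLaw M π s (reachAvoid T Av) = 0}

/-- The expected length of the joint path under full communication, until a target state or a dead
state is visited. -/
def expLen (M : ∀ i, MDP (S i) (A i)) (π : Joint S → PMF (Joint A)) (T Av : Set (Joint S)) : ℝ≥0∞ :=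
  ∫⁻ ω, pathLen (T ∪ deadStates M π T Av) ω ∂fullLaw M π (initState M)

/-- The law of the path of agent `i` under full communication. -/
def agentLaw (M : ∀ i, MDP (S i) (A i)) (π : Joint S → PMF (Joint A)) (i : ι) :
    Measure (ℕ → S i × A i) :=
  (fullLaw M π (initState M)).map (agentPath i)

/-- The total correlation of the joint policy: the Kullback-Leibler divergence of the joint law of
the agents' paths from the product of its marginals, under full communication. -/
def totalCorrelation (M : ∀ i, MDP (S i) (A i)) (π : Joint S → PMF (Joint A)) : ℝ≥0∞ :=
  InformationTheory.klDiv ((fullLaw M π (initState M)).map teamPath)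
    (Measure.pi fun i => agentLaw M π i)

end Game

open Classical in
/-- The Shannon entropy (in nats) of a probability distribution: the usual sum if the distribution
is discrete, that is, carried by a countable set, and `∞` otherwise. -/
def entropy {α : Type*} [MeasurableSpace α] (P : Measure α) : ℝ≥0∞ :=
  if ∃ D : Set α, D.Countable ∧ P Dᶜ = 0 then
    ∑' x, ENNReal.ofReal (Real.negMulLog (P.real {x}))
  else ∞

end

end ReachAvoid

/-! The entropy identity says that cross entropy is divergence plus entropy (`klDiv_add_tsum`). If
all marginals are discrete, the logarithm of a product measure at an atom is a sum over the agents,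
so the cross entropy is the sum of the marginal entropies. If some marginal is not discrete, neither
is the joint law, and both sides are infinite.

Everything else is computed on finite words, whose laws are products of one-step weights, and passes
to the limit in the number of steps.

Discount bound. While communication is available at every time, the intermittent execution is the
full one. Hence the intermittent value is at least the expectation of (1 - q)^τ on success, where τ
counts the states up to the target (`stateDisc_le_reachProb`). Jensen's inequality on the success
event, together with E[τ; success] ≤ l, turns this into v (1 - q)^(l / v)
(`stateReach_mul_rpow_le`). The length l is finite because, outside targets and dead states, success
has positive probability within a uniform number of steps, so that survival decays geometrically
(`exists_stateLen_le`).

Correlation bound. Attach the independent communication flags to the full execution as well, and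
compare the two laws of flags together with the true joint path. Without communication, the pair (ŝ,
â) of each agent is a separate copy of the full chain, advancing independently of the others. Given
the flags and the true path, the copies are independent, and the copy of agent i is distributed as
the filter (`belief`) computed from its own path and the full observations
(`sum_jointWeight_mul_prod`). So under intermittent communication the true components move, at a
dropout, by the product of the agents' own predictions.

The log-likelihood ratio of the two laws therefore grows only at dropouts, each of probability q
independently of the past. Additional full observations can only improve the expected log score of a
prediction (`sum_flagWeight_log_predictObs_le`), so the divergence is at most q times that between
the joint law of finite paths and the product of its marginals (`sum_logRatio_le`). By data
processing the latter is at most the total correlation. The Bretagnolle-Huber inequality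
(`sum_mul_sub_sum_mul_le_sqrt`) converts this into a bound on success probabilities. -/

namespace ReachAvoid

noncomputable section

/-! ### Words

A word is a finite trajectory, listed with the most recent letter first. -/

section Words

variable {Y : Type*}

/-- The words of length `n`. -/
def words (Y : Type*) [Fintype Y] : ℕ → Finset (List Y)
  | 0 => {[]}
  | n + 1 => (words Y n ×ˢ Finset.univ).map
      ⟨fun p => p.2 :: p.1, fun p p' h => by
        simp only [List.cons.injEq] at h
        exact Prod.ext h.2 h.1⟩

/-- The word formed by the first `n` letters of a trajectory. -/
def prefixWord : ℕ → (ℕ → Y) → List Y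
  | 0, _ => []
  | n + 1, ω => ω n :: prefixWord n ω

/-- The weight of a word when the weight of the letter `z` following the word `h` is `k h z`. -/
def weight (k : List Y → Y → ℝ) : List Y → ℝ
  | [] => 1
  | z :: h => weight k h * k h z

@[simp] lemma sum_words_zero [Fintype Y] (f : List Y → ℝ) : ∑ h ∈ words Y 0, f h = f [] := by
  simp [words]

lemma sum_words_succ [Fintype Y] (n : ℕ) (f : List Y → ℝ) :
    ∑ h ∈ words Y (n + 1), f h = ∑ h ∈ words Y n, ∑ z, f (z :: h) := by
  rw [words, Finset.sum_map, Finset.sum_product]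
  rfl

/-- Words grow at the head, which is the latest letter; this splits off the oldest letter instead,
as first-step analysis requires. -/
lemma sum_words_succ_append [Fintype Y] (n : ℕ) (f : List Y → ℝ) :
    ∑ h ∈ words Y (n + 1), f h = ∑ z, ∑ h ∈ words Y n, f (h ++ [z]) := by
  induction n generalizing f with
  | zero => simp [sum_words_succ]
  | succ n ih =>
    rw [sum_words_succ, ih]
    refine Finset.sum_congr rfl fun z _ => ?_
    rw [sum_words_succ]
    rfl

lemma mem_words [Fintype Y] {n : ℕ} {h : List Y} : h ∈ words Y n ↔ h.length = n := by
  induction n generalizing h with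
  | zero => simp [words]
  | succ n ih =>
    cases h with
    | nil => simp [words]
    | cons z h =>
      simp only [words, Finset.mem_map, Finset.mem_product, Finset.mem_univ, and_true,
        Prod.exists, List.length_cons, Nat.add_right_cancel_iff, ← ih]
      refine ⟨fun ⟨a, b, ha, hab⟩ => ?_, fun hh => ⟨h, z, hh, rfl⟩⟩
      obtain ⟨_, rfl⟩ := List.cons.inj hab
      exact ha

@[simp] lemma length_prefixWord (n : ℕ) (ω : ℕ → Y) : (prefixWord n ω).length = n := by
  induction n with
  | zero => rfl
  | succ n ih => simp [prefixWord, ih]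

lemma prefixWord_succ_eq_append (n : ℕ) (ω : ℕ → Y) :
    prefixWord (n + 1) ω = prefixWord n (fun t => ω (t + 1)) ++ [ω 0] := by
  induction n with
  | zero => rfl
  | succ n ih => rw [prefixWord, ih]; rfl

lemma prefixWord_eq_iff {n : ℕ} {ω ω' : ℕ → Y} :
    prefixWord n ω = prefixWord n ω' ↔ ∀ t < n, ω t = ω' t := by
  induction n with
  | zero => simp [prefixWord]
  | succ n ih => simp only [prefixWord, List.cons.injEq, ih, Nat.forall_lt_succ_right, and_comm]

lemma map_prefixWord {X : Type*} (f : Y → X) (n : ℕ) (ω : ℕ → Y) :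
    (prefixWord n ω).map f = prefixWord n fun t => f (ω t) := by
  induction n with
  | zero => rfl
  | succ n ih => simp [prefixWord, ih]

lemma weight_nonneg {k : List Y → Y → ℝ} (hk : ∀ h z, 0 ≤ k h z) (h : List Y) :
    0 ≤ weight k h := by
  induction h with
  | nil => simp [weight]
  | cons z h ih => exact mul_nonneg ih (hk h z)

lemma sum_weight_eq_one [Fintype Y] {k : List Y → Y → ℝ} (hk1 : ∀ h, ∑ z, k h z = 1) (n : ℕ) :
    ∑ h ∈ words Y n, weight k h = 1 := by
  induction n with
  | zero => simp [weight]
  | succ n ih =>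
    rw [sum_words_succ, ← ih]
    refine Finset.sum_congr rfl fun h _ => ?_
    simp only [weight, ← Finset.mul_sum, hk1, mul_one]

end Words

/-! ### Finite-dimensional laws of a Markov chain -/

section Chain

variable {Z : Type*}

/-- The one-step weights of a Markov chain, from `none` at the start. -/
def optStep (init : PMF Z) (step : Z → PMF Z) (c : Option Z) (z : Z) : ℝ :=
  ((c.elim init step) z).toReal

lemma optStep_nonneg (init : PMF Z) (step : Z → PMF Z) (c : Option Z) (z : Z) :
    0 ≤ optStep init step c z := ENNReal.toReal_nonneg

lemma PMF.sum_toReal [Fintype Z] (p : PMF Z) : ∑ z, (p z).toReal = 1 := by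
  rw [← ENNReal.toReal_sum fun z _ => p.apply_ne_top z, ← tsum_fintype (L := .unconditional _),
    p.tsum_coe, ENNReal.toReal_one]

lemma sum_optStep [Fintype Z] (init : PMF Z) (step : Z → PMF Z) (c : Option Z) :
    ∑ z, optStep init step c z = 1 := PMF.sum_toReal _

/-- The probability that a Markov chain starts with a given word. -/
def chainWeight (init : PMF Z) (step : Z → PMF Z) : List Z → ℝ :=
  weight fun h z => optStep init step h.head? z

lemma sum_chainWeight [Fintype Z] (init : PMF Z) (step : Z → PMF Z) (n : ℕ) :
    ∑ h ∈ words Z n, chainWeight init step h = 1 := sum_weight_eq_one (fun _ => sum_optStep _ _ _) n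

lemma chainWeight_append (init : PMF Z) (step : Z → PMF Z) (h : List Z) (z : Z) :
    chainWeight init step (h ++ [z]) = (init z).toReal * chainWeight (step z) step h := by
  induction h with
  | nil => simp [chainWeight, weight, optStep]
  | cons x h ih =>
    unfold chainWeight at ih ⊢
    simp only [List.cons_append, weight, ih]
    rw [mul_assoc]
    congr 2
    cases h <;> rfl

variable [Fintype Z] [MeasurableSpace Z] [MeasurableSingletonClass Z]

lemma isMarkovKernel_step (step : Z → PMF Z) :
    IsMarkovKernel (Kernel.ofFunOfCountable fun z => (step z).toMeasure) :=
  ⟨fun z => PMF.toMeasure.isProbabilityMeasure (step z)⟩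

instance isProbabilityMeasure_chainLaw (init : PMF Z) (step : Z → PMF Z) :
    IsProbabilityMeasure (chainLaw init step) := by
  unfold chainLaw
  have := PMF.toMeasure.isProbabilityMeasure init
  infer_instance

/-- The discrete measurable structure on words. -/
abbrev wordsMeasurableSpace (Z : Type*) : MeasurableSpace (List Z) := ⊤

attribute [local instance] wordsMeasurableSpace

instance measurableSingletonClass_words (Z : Type*) : MeasurableSingletonClass (List Z) :=
  ⟨fun _ => MeasurableSpace.measurableSet_top⟩

lemma measurable_prefixWord (n : ℕ) : Measurable (prefixWord n : (ℕ → Z) → List Z) := by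
  induction n with
  | zero => exact measurable_const
  | succ n ih =>
    have : Measurable fun p : Z × List Z => p.1 :: p.2 := measurable_of_countable _
    exact this.comp ((measurable_pi_apply n).prodMk ih)

lemma measurableSet_prefixWord (n : ℕ) (A : Set (List Z)) :
    MeasurableSet {ω : ℕ → Z | prefixWord n ω ∈ A} :=
  measurable_prefixWord n (MeasurableSpace.measurableSet_top)

/-- The link between the trajectory measure and finite sums. The word is built up one letter at a
time, by the disintegration of the trajectory law over its restriction to the times up to `n`. -/
lemma chainLaw_prefixWord (init : PMF Z) (step : Z → PMF Z) (h : List Z) :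
    (chainLaw init step).real {ω | prefixWord h.length ω = h} = chainWeight init step h := by
  have := isMarkovKernel_step step
  induction h with
  | nil => simp [prefixWord, chainWeight, weight]
  | cons z h ih =>
    cases h with
    | nil =>
      have : {ω : ℕ → Z | prefixWord [z].length ω = [z]} =
          Preorder.frestrictLe (π := fun _ => Z) 0 ⁻¹' {x | x ⟨0, by simp⟩ = z} := by
        ext ω
        simp [prefixWord, Preorder.frestrictLe]
      have hm : MeasurableSet {x : ∀ i : Finset.Iic (0 : ℕ), Z | x ⟨0, by simp⟩ = z} :=
        measurable_pi_apply (X := fun _ : Finset.Iic (0 : ℕ) => Z) ⟨0, by simp⟩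
          (measurableSet_singleton z)
      rw [this, ← map_measureReal_apply (by fun_prop) hm, chainLaw, Kernel.trajMeasure,
        Measure.map_comp _ _ (by fun_prop), Kernel.traj_map_frestrictLe, Kernel.partialTraj_self,
        Measure.id_comp, map_measureReal_apply (by fun_prop) hm]
      have h2 : (⇑(MeasurableEquiv.piUnique fun i : Finset.Iic (0 : ℕ) => Z).symm) ⁻¹'
          {x | x ⟨0, by simp⟩ = z} = {z} := by
        ext y
        simp [MeasurableEquiv.piUnique, Equiv.piUnique]
      simp only [chainWeight, weight, optStep, List.head?_nil, Option.elim_none, one_mul]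
      erw [h2]
      rw [measureReal_def, PMF.toMeasure_apply_singleton _ _ (measurableSet_singleton z)]
    | cons z' h =>
      set n := h.length with hn
      -- A history up to time `n` is extended to all times by freezing it at `n`, so that
      -- `prefixWord` applies to it.
      set S : Set (∀ i : Finset.Iic n, Z) :=
        {x | prefixWord (n + 1) (fun t => x ⟨min t n, by simp⟩) = z' :: h} with hS
      have hSm : MeasurableSet S := by
        have : Measurable fun (x : ∀ i : Finset.Iic n, Z) (t : ℕ) =>
            x ⟨min t n, by simp⟩ := measurable_pi_lambda _ fun t => measurable_pi_apply _
        exact this (measurableSet_prefixWord (n + 1) {z' :: h})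
      have hres : ∀ ω : ℕ → Z, Preorder.frestrictLe (π := fun _ => Z) n ω ∈ S ↔
          prefixWord (n + 1) ω = z' :: h := by
        intro ω
        rw [hS, Set.mem_ofPred_eq, prefixWord_eq_iff.2 fun t ht => ?_]
        simp [Preorder.frestrictLe, min_eq_left (Nat.lt_succ_iff.1 ht)]
      have hset : {ω : ℕ → Z | prefixWord (z :: z' :: h).length ω = z :: z' :: h} =
          (fun ω => (Preorder.frestrictLe (π := fun _ => Z) n ω, ω (n + 1))) ⁻¹' (S ×ˢ {z}) := by
        ext ω
        simp only [List.length_cons, ← hn, Set.mem_ofPred_eq, Set.mem_preimage, Set.mem_prod, hres,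
          Set.mem_singleton_iff]
        rw [prefixWord, List.cons.injEq, and_comm]
      have hpre : {ω : ℕ → Z | prefixWord (z' :: h).length ω = z' :: h} =
          Preorder.frestrictLe (π := fun _ => Z) n ⁻¹' S := by
        ext ω
        exact (hres ω).symm
      have hstep : chainWeight init step (z :: z' :: h) =
          chainWeight init step (z' :: h) * (step z' z).toReal := rfl
      rw [hstep, ← ih, hset, hpre, measureReal_def, measureReal_def, ← ENNReal.toReal_mul]
      congr 1
      rw [← Measure.map_apply (by fun_prop) (hSm.prod (measurableSet_singleton z)),
        ← Measure.map_apply (by fun_prop) hSm]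
      have := PMF.toMeasure.isProbabilityMeasure init
      unfold chainLaw
      rw [← Kernel.map_frestrictLe_trajMeasure_compProd_eq_map_trajMeasure,
        Measure.compProd_apply_prod hSm (measurableSet_singleton z)]
      rw [setLIntegral_congr_fun (g := fun _ => step z' z) hSm, setLIntegral_const, mul_comm]
      intro x hx
      have hx' : x ⟨n, by simp⟩ = z' := by
        rw [hS, Set.mem_ofPred_eq, prefixWord, List.cons.injEq] at hx
        simpa using hx.1
      simp only [Kernel.comap_apply, Kernel.ofFunOfCountable, Kernel.coe_mk, hx']
      rw [PMF.toMeasure_apply_singleton _ _ (measurableSet_singleton z)]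

lemma integral_prefixWord (init : PMF Z) (step : Z → PMF Z) (n : ℕ) (F : List Z → ℝ) :
    ∫ ω, F (prefixWord n ω) ∂chainLaw init step =
      ∑ h ∈ words Z n, chainWeight init step h * F h := by
  have h1 : ∀ ω : ℕ → Z, F (prefixWord n ω) =
      ∑ h ∈ words Z n, Set.indicator {ω | prefixWord n ω = h} (fun _ => F h) ω := by
    intro ω
    rw [Finset.sum_eq_single (prefixWord n ω)]
    · simp
    · intro h _ hne
      simp [hne.symm]
    · simp [mem_words]
  simp_rw [h1]
  rw [integral_finsetSum _ fun h _ => (integrable_const _).indicator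
    (measurableSet_prefixWord n {h})]
  refine Finset.sum_congr rfl fun h hh => ?_
  rw [integral_indicator_const _ (show MeasurableSet {ω | prefixWord n ω = h} from
    measurableSet_prefixWord n {h}), smul_eq_mul, ← chainLaw_prefixWord, mem_words.1 hh]

end Chain

/-! ### Entropy and total correlation -/

section Entropy

variable {α : Type*} [MeasurableSpace α]

lemma entropy_eq_tsum {P : Measure α} {D : Set α} (hD : D.Countable) (hP : P Dᶜ = 0) :
    entropy P = ∑' x, ENNReal.ofReal (Real.negMulLog (P.real {x})) := by
  rw [entropy, if_pos ⟨D, hD, hP⟩]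

lemma entropy_map_equiv {β : Type*} [MeasurableSpace β] (e : α ≃ᵐ β) (P : Measure α) :
    entropy (P.map e) = entropy P := by
  have hiff : (∃ D : Set β, D.Countable ∧ P.map e Dᶜ = 0) ↔ ∃ D : Set α, D.Countable ∧ P Dᶜ = 0 := by
    constructor
    · rintro ⟨D, hD, h⟩
      rw [e.map_apply] at h
      exact ⟨e ⁻¹' D, hD.preimage e.injective, h⟩
    · rintro ⟨D, hD, h⟩
      refine ⟨e.symm ⁻¹' D, hD.preimage e.symm.injective, ?_⟩
      rw [e.map_apply]
      convert h
      ext x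
      simp
  unfold entropy
  by_cases h : ∃ D : Set α, D.Countable ∧ P Dᶜ = 0
  swap
  · rw [if_neg h, if_neg (hiff.not.2 h)]
  rw [if_pos h, if_pos (hiff.2 h)]
  rw [← e.toEquiv.tsum_eq]
  refine tsum_congr fun x => ?_
  rw [measureReal_def, e.map_apply, measureReal_def]
  congr 4
  ext y
  simp

variable [MeasurableSingletonClass α]

lemma lintegral_eq_tsum_of_countable {P : Measure α} {D : Set α} (hD : D.Countable)
    (hP : P Dᶜ = 0) (f : α → ℝ≥0∞) : ∫⁻ x, f x ∂P = ∑' x, f x * P {x} := by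
  rw [← Measure.restrict_eq_self_of_ae_mem (s := D) (μ := P) (by
    rw [ae_iff]; exact hP), lintegral_countable _ hD, Measure.restrict_eq_self_of_ae_mem (by
    rw [ae_iff]; exact hP)]
  refine tsum_subtype_eq_of_support_subset (f := fun x => f x * P {x}) fun x hx => ?_
  by_contra hxD
  exact hx (by
    change f x * P {x} = 0
    rw [measure_mono_null (Set.singleton_subset_iff.2 hxD) hP, mul_zero])

lemma rnDeriv_mul_singleton {P Q : Measure α} [IsFiniteMeasure P] [IsFiniteMeasure Q]
    (hPQ : P ≪ Q) (x : α) : P.rnDeriv Q x * Q {x} = P {x} := by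
  conv_rhs => rw [← Measure.withDensity_rnDeriv_eq P Q hPQ]
  rw [withDensity_apply _ (measurableSet_singleton x), lintegral_singleton]

/-- The relative entropy with respect to a discrete distribution is the cross entropy minus the
entropy. -/
lemma klDiv_add_tsum {P Q : Measure α} [IsProbabilityMeasure P] [IsProbabilityMeasure Q]
    (hPQ : P ≪ Q) {D : Set α} (hD : D.Countable) (hQ : Q Dᶜ = 0) :
    InformationTheory.klDiv P Q + ∑' x, ENNReal.ofReal (Real.negMulLog (P.real {x})) =
      ∑' x, ENNReal.ofReal (-(P.real {x} * Real.log (Q.real {x}))) := by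
  have hsum : ∀ R : Measure α, IsProbabilityMeasure R → R Dᶜ = 0 → ∑' x, R {x} = 1 := by
    intro R _ hR
    have := lintegral_eq_tsum_of_countable hD hR fun _ => 1
    simpa using this.symm
  -- Adding the total mass `1` to both sides, as the sum of the atoms of `P` on the left and of `Q`
  -- on the right, cancels the terms `1 - u` of `klFun u` and gives an identity that holds atom by
  -- atom between nonnegative terms.
  rw [← ENNReal.add_left_inj ENNReal.one_ne_top]
  conv_lhs => rw [← hsum P inferInstance (hPQ hQ)]
  conv_rhs => rw [← hsum Q inferInstance hQ]
  rw [InformationTheory.klDiv_eq_lintegral_klFun_of_ac hPQ,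
    lintegral_eq_tsum_of_countable hD hQ, ← ENNReal.tsum_add, ← ENNReal.tsum_add,
    ← ENNReal.tsum_add]
  refine tsum_congr fun x => ?_
  set u := (P.rnDeriv Q x).toReal with hu
  have hP : P.real {x} = u * Q.real {x} := by
    rw [measureReal_def, ← rnDeriv_mul_singleton hPQ x, ENNReal.toReal_mul, measureReal_def]
  have hu0 : 0 ≤ u := ENNReal.toReal_nonneg
  have hQ0 : 0 ≤ Q.real {x} := measureReal_nonneg
  have hQ1 : Q.real {x} ≤ 1 := measureReal_le_one
  have hP0 : 0 ≤ P.real {x} := measureReal_nonneg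
  have hP1 : P.real {x} ≤ 1 := measureReal_le_one
  have hk := InformationTheory.klFun_nonneg hu0
  have hlog : 0 ≤ -(P.real {x} * Real.log (Q.real {x})) := by
    rw [neg_nonneg]
    exact mul_nonpos_of_nonneg_of_nonpos hP0 (Real.log_nonpos hQ0 hQ1)
  have hneg : 0 ≤ Real.negMulLog (P.real {x}) := Real.negMulLog_nonneg hP0 hP1
  rw [← ofReal_measureReal, ← ofReal_measureReal, ← ENNReal.ofReal_mul hk,
    ← ENNReal.ofReal_add (by positivity) hneg, ← ENNReal.ofReal_add (by positivity) hP0,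
    ← ENNReal.ofReal_add hlog hQ0]
  congr 1
  rw [hP, InformationTheory.klFun_apply, Real.negMulLog]
  rcases eq_or_ne u 0 with h | h
  · simp [h]
  rcases eq_or_ne (Q.real {x}) 0 with h' | h'
  · simp [h']
  rw [Real.log_mul h h']
  ring

lemma entropy_eq_lintegral {P : Measure α} [IsProbabilityMeasure P] {D : Set α}
    (hD : D.Countable) (hP : P Dᶜ = 0) :
    entropy P = ∫⁻ x, ENNReal.ofReal (-Real.log (P.real {x})) ∂P := by
  rw [entropy_eq_tsum hD hP, lintegral_eq_tsum_of_countable hD hP]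
  refine tsum_congr fun x => ?_
  rw [← ofReal_measureReal, ← ENNReal.ofReal_mul (by
    simpa using Real.log_nonpos measureReal_nonneg measureReal_le_one), Real.negMulLog]
  congr 1
  ring

end Entropy

section TotalCorrelation

variable {ι : Type*} [Fintype ι] {X : ι → Type*} [∀ i, MeasurableSpace (X i)]
  [∀ i, MeasurableSingletonClass (X i)]

/-- A null atom of the product has a null coordinate, and the joint atom lies in the preimage of
that coordinate. In the discrete case this gives absolute continuity with respect to the product of
the marginals. -/
lemma prod_map_eval_eq_zero {P : Measure (∀ i, X i)} [IsProbabilityMeasure P] {x : ∀ i, X i}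
    (hx : Measure.pi (fun i => P.map fun x => x i) {x} = 0) : P {x} = 0 := by
  have hprob (i : ι) : IsProbabilityMeasure (P.map fun x => x i) :=
    Measure.isProbabilityMeasure_map (measurable_pi_apply i).aemeasurable
  rw [← Set.univ_pi_singleton, Measure.pi_pi, Finset.prod_eq_zero_iff] at hx
  obtain ⟨i, _, hi⟩ := hx
  rw [Measure.map_apply (measurable_pi_apply i) (measurableSet_singleton _)] at hi
  refine measure_mono_null (fun y hy => ?_) hi
  simp only [Set.mem_singleton_iff] at hy
  simp [hy]

/-- The sum of the marginal entropies is the total correlation plus the joint entropy. -/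
theorem sum_entropy_map_eval (P : Measure (∀ i, X i)) [IsProbabilityMeasure P] :
    ∑ i, entropy (P.map fun x => x i) =
      InformationTheory.klDiv P (Measure.pi fun i => P.map fun x => x i) + entropy P := by
  classical
  have hprob (i : ι) : IsProbabilityMeasure (P.map fun x => x i) :=
    Measure.isProbabilityMeasure_map (measurable_pi_apply i).aemeasurable
  by_cases hdisc : ∀ i, ∃ D : Set (X i), D.Countable ∧ P.map (fun x => x i) Dᶜ = 0
  · choose D hD hPD using hdisc
    set Q := Measure.pi fun i => P.map fun x => x i with hQ
    have hDc : (Set.univ.pi D).Countable := Set.countable_univ_pi hD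
    have hcompl : (Set.univ.pi D)ᶜ = ⋃ i, Function.eval i ⁻¹' (D i)ᶜ := by
      ext x
      simp
    have hPc : P (Set.univ.pi D)ᶜ = 0 := by
      rw [hcompl, measure_iUnion_null_iff]
      intro i
      have := hPD i
      rwa [Measure.map_apply (measurable_pi_apply i) (hD i).measurableSet.compl] at this
    have hQc : Q (Set.univ.pi D)ᶜ = 0 := by
      rw [hcompl, measure_iUnion_null_iff]
      intro i
      exact Measure.pi_eval_preimage_null _ (hPD i)
    have hac : P ≪ Q := by
      intro s hs
      have hs' : P (⋃ x ∈ s ∩ Set.univ.pi D, {x}) = 0 := by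
        rw [measure_biUnion_null_iff (hDc.mono Set.inter_subset_right)]
        intro x hx
        exact prod_map_eval_eq_zero (measure_mono_null (Set.singleton_subset_iff.2 hx.1) hs)
      rw [Set.biUnion_of_singleton] at hs'
      refine measure_mono_null (fun x hx => ?_) (measure_union_null hs' hPc)
      by_cases hxD : x ∈ Set.univ.pi D
      · exact Or.inl ⟨hx, hxD⟩
      · exact Or.inr hxD
    rw [entropy_eq_tsum hDc hPc, klDiv_add_tsum hac hDc hQc]
    -- Outside the countable set `D i` the atoms have mass `0`, and `Real.log 0 = 0`, so the
    -- function vanishes there.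
    have hmeas (i : ι) : Measurable fun y =>
        ENNReal.ofReal (-Real.log ((P.map fun x => x i).real {y})) := by
      refine Measurable.measurable_of_countable_ne (f := fun _ => 0) measurable_const
        ((hD i).mono fun y hy => ?_)
      by_contra hyD
      refine hy ?_
      rw [measureReal_def, measure_mono_null (Set.singleton_subset_iff.2 hyD) (hPD i)]
      simp
    have hent (i : ι) : entropy (P.map fun x => x i) =
        ∑' x, ENNReal.ofReal (-Real.log ((P.map fun x => x i).real {x i})) * P {x} := by
      rw [entropy_eq_lintegral (hD i) (hPD i), lintegral_map (hmeas i) (measurable_pi_apply i),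
        lintegral_eq_tsum_of_countable hDc hPc]
    simp_rw [hent]
    rw [← Summable.tsum_finsetSum fun _ _ => ENNReal.summable]
    refine tsum_congr fun x => ?_
    rcases eq_or_ne (P {x}) 0 with h0 | h0
    · simp [measureReal_def, h0]
    have hQx : Q {x} ≠ 0 := fun h => h0 (prod_map_eval_eq_zero h)
    have hQprod : Q.real {x} = ∏ i, (P.map fun x => x i).real {x i} := by
      rw [measureReal_def, ← Set.univ_pi_singleton, hQ, Measure.pi_pi, ENNReal.toReal_prod]
      rfl
    have hne : ∀ i ∈ Finset.univ, (P.map fun x => x i).real {x i} ≠ 0 := by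
      rw [← Finset.prod_ne_zero_iff, ← hQprod]
      simpa [measureReal_eq_zero_iff] using hQx
    have hnn (i : ι) : 0 ≤ -Real.log ((P.map fun x => x i).real {x i}) := by
      simpa using Real.log_nonpos measureReal_nonneg measureReal_le_one
    rw [← Finset.sum_mul, ← ENNReal.ofReal_sum_of_nonneg fun i _ => hnn i, ← ofReal_measureReal,
      ← ENNReal.ofReal_mul (Finset.sum_nonneg fun i _ => hnn i), hQprod, Real.log_prod hne]
    congr 1
    rw [Finset.sum_neg_distrib]
    ring
  · push Not at hdisc
    obtain ⟨i, hi⟩ := hdisc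
    have htop : entropy (P.map fun x => x i) = ∞ := by
      rw [entropy, if_neg]
      rintro ⟨D, hD, h⟩
      exact hi D hD h
    have htop' : entropy P = ∞ := by
      rw [entropy, if_neg]
      rintro ⟨D, hD, h⟩
      -- A countable carrier of the joint law would project to a countable carrier of the `i`-th
      -- marginal.
      refine hi ((fun x => x i) '' D) (hD.image _) ?_
      rw [Measure.map_apply (measurable_pi_apply i) (hD.image _).measurableSet.compl]
      refine measure_mono_null (t := Dᶜ) ?_ h
      intro x hx hxD
      exact hx ⟨x, hxD, rfl⟩
    rw [htop', add_top, ENNReal.sum_eq_top]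
    exact ⟨i, Finset.mem_univ i, htop⟩

end TotalCorrelation

/-! ### The entropy identity for the agents' paths -/

section Team

variable {ι : Type*} {S A : ι → Type*} [∀ i, MeasurableSpace (S i)] [∀ i, MeasurableSpace (A i)]

/-- A joint path is the same thing as the family of the paths of all agents. -/
def teamPathEquiv : JointPath S A ≃ᵐ (∀ i, ℕ → S i × A i) where
  toFun := teamPath
  invFun x t := (fun i => (x i t).1, fun i => (x i t).2)
  left_inv _ := rfl
  right_inv _ := rfl
  measurable_toFun := by
    change Measurable teamPath
    unfold teamPath agentPath
    fun_prop
  measurable_invFun := by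
    change Measurable fun (x : ∀ i, ℕ → S i × A i) (t : ℕ) =>
      ((fun i => (x i t).1, fun i => (x i t).2) : Joint S × Joint A)
    fun_prop

lemma measurable_teamPath : Measurable (teamPath : JointPath S A → _) :=
  teamPathEquiv.measurable

lemma measurable_agentPath (i : ι) : Measurable (agentPath i : JointPath S A → _) :=
  (measurable_pi_apply i).comp measurable_teamPath

variable [Fintype ι] [DecidableEq ι] [∀ i, Fintype (S i)] [∀ i, MeasurableSingletonClass (S i)]
  [∀ i, Fintype (A i)] [∀ i, MeasurableSingletonClass (A i)]

instance isProbabilityMeasure_fullLaw (M : ∀ i, MDP (S i) (A i)) (π : Joint S → PMF (Joint A))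
    (s : Joint S) : IsProbabilityMeasure (fullLaw M π s) :=
  isProbabilityMeasure_chainLaw _ _

lemma map_eval_teamPath (M : ∀ i, MDP (S i) (A i)) (π : Joint S → PMF (Joint A)) (i : ι) :
    ((fullLaw M π (initState M)).map teamPath).map (fun x => x i) = agentLaw M π i :=
  Measure.map_map (measurable_pi_apply i) measurable_teamPath

theorem sum_entropy_agentLaw (M : ∀ i, MDP (S i) (A i)) (π : Joint S → PMF (Joint A)) :
    ∑ i, entropy (agentLaw M π i) =
      totalCorrelation M π + entropy (fullLaw M π (initState M)) := by
  have : IsProbabilityMeasure ((fullLaw M π (initState M)).map teamPath) :=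
    Measure.isProbabilityMeasure_map measurable_teamPath.aemeasurable
  have h := sum_entropy_map_eval ((fullLaw M π (initState M)).map teamPath)
  simp only [map_eval_teamPath] at h
  rw [h, totalCorrelation]
  congr 1
  exact entropy_map_equiv teamPathEquiv _

end Team

/-! ### Functionals of trajectories that satisfy a first-step recursion -/

section WordVal

variable {Z : Type*}

/-- The total `a z₀ + b z₀ * (a z₁ + b z₁ * …)` of the finite trajectory `z₀ z₁ …`. -/
def listVal (a b : Z → ℝ) : List Z → ℝ
  | [] => 0
  | z :: l => a z + b z * listVal a b l

/-- The total `a z₀ + b z₀ * (a z₁ + b z₁ * …)` of the trajectory listed by a word. -/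
def wordVal (a b : Z → ℝ) (h : List Z) : ℝ := listVal a b h.reverse

/-- The expected total over `n` steps of the Markov chain started in a given state. -/
def chainVal [Fintype Z] (step : Z → PMF Z) (a b : Z → ℝ) : ℕ → Z → ℝ
  | 0, _ => 0
  | n + 1, z => a z + b z * ∑ z', (step z z').toReal * chainVal step a b n z'

@[simp] lemma wordVal_nil (a b : Z → ℝ) : wordVal a b [] = 0 := rfl

lemma wordVal_append (a b : Z → ℝ) (h : List Z) (z : Z) :
    wordVal a b (h ++ [z]) = a z + b z * wordVal a b h := by
  simp [wordVal, listVal]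

lemma wordVal_map {X : Type*} (a b : X → ℝ) (f : Z → X) (h : List Z) :
    wordVal a b (h.map f) = wordVal (fun z => a (f z)) (fun z => b (f z)) h := by
  unfold wordVal
  rw [← List.map_reverse]
  induction h.reverse with
  | nil => rfl
  | cons z l ih => simp [listVal, ih]

/-- First-step analysis: conditioning on the oldest letter restarts the chain from that state. It is
used for success probabilities and for truncated hitting times, which are both affine recursions
along the path. -/
lemma sum_chainWeight_wordVal [Fintype Z] (init : PMF Z) (step : Z → PMF Z) (a b : Z → ℝ) (n : ℕ) :
    ∑ h ∈ words Z n, chainWeight init step h * wordVal a b h =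
      ∑ z, (init z).toReal * chainVal step a b n z := by
  induction n generalizing init with
  | zero => simp [chainVal]
  | succ n ih =>
    rw [sum_words_succ_append]
    refine Finset.sum_congr rfl fun z _ => ?_
    simp only [chainWeight_append, wordVal_append, chainVal, ← ih, mul_assoc, ← Finset.mul_sum]
    congr 1
    simp only [mul_add, Finset.sum_add_distrib, ← Finset.sum_mul, sum_chainWeight, one_mul,
      Finset.mul_sum]
    congr 1
    exact Finset.sum_congr rfl fun h _ => by ring

end WordVal

/-! ### Success probabilities as first-step recursions -/

section Reach

open Classical in
/-- The indicator function of a set of states. -/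
def ind {Z : Type*} (T : Set Z) (z : Z) : ℝ := if z ∈ T then 1 else 0

lemma ind_nonneg {Z : Type*} (T : Set Z) (z : Z) : 0 ≤ ind T z := by
  unfold ind; split_ifs <;> norm_num

lemma ind_of_mem {Z : Type*} {T : Set Z} {z : Z} (h : z ∈ T) : ind T z = 1 := if_pos h

lemma ind_compl_of_mem {Z : Type*} {T : Set Z} {z : Z} (h : z ∈ T) : ind Tᶜ z = 0 :=
  if_neg fun hz => hz h

lemma ind_of_notMem {Z : Type*} {T : Set Z} {z : Z} (h : z ∉ T) : ind T z = 0 := if_neg h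

variable {Z : Type*}

/-- The trajectories that reach `T` within the first `n` letters and do not visit `Av` before. -/
def reachBy (T Av : Set Z) (n : ℕ) : Set (ℕ → Z) := {ω | ∃ m < n, ω m ∈ T ∧ ∀ t < m, ω t ∉ Av}

/-- The indicator, on words, of reaching `T` without visiting `Av` before. -/
def reachVal (T Av : Set Z) : List Z → ℝ := wordVal (ind T) (ind (T ∪ Av)ᶜ)

lemma mem_reachBy_succ {T Av : Set Z} {n : ℕ} {ω : ℕ → Z} :
    ω ∈ reachBy T Av (n + 1) ↔ ω 0 ∈ T ∨ ω 0 ∉ Av ∧ (fun t => ω (t + 1)) ∈ reachBy T Av n := by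
  constructor
  · rintro ⟨m, hm, hT, hA⟩
    cases m with
    | zero => exact Or.inl hT
    | succ m =>
      exact Or.inr ⟨hA 0 (by omega), m, by omega, hT, fun t ht => hA (t + 1) (by omega)⟩
  · rintro (h | ⟨h0, m, hm, hT, hA⟩)
    · exact ⟨0, by omega, h, by simp⟩
    · refine ⟨m + 1, by omega, hT, fun t ht => ?_⟩
      cases t with
      | zero => exact h0
      | succ t => exact hA t (by omega)

lemma reachVal_prefixWord (T Av : Set Z) (n : ℕ) (ω : ℕ → Z) :
    reachVal T Av (prefixWord n ω) = ind (reachBy T Av n) ω := by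
  induction n generalizing ω with
  | zero =>
    rw [ind_of_notMem]
    · rfl
    · rintro ⟨m, hm, _⟩
      omega
  | succ n ih =>
    unfold reachVal at ih ⊢
    rw [prefixWord_succ_eq_append, wordVal_append, ih]
    classical
    have h1 : ind (reachBy T Av (n + 1)) ω = if ω 0 ∈ T ∨ ω 0 ∉ Av ∧
        (fun t => ω (t + 1)) ∈ reachBy T Av n then 1 else 0 := by
      unfold ind
      exact if_congr mem_reachBy_succ rfl rfl
    rw [h1]
    unfold ind
    by_cases h : ω 0 ∈ T <;> by_cases h' : ω 0 ∈ Av <;> simp [h, h']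

lemma reachVal_mem_Icc (T Av : Set Z) (h : List Z) : reachVal T Av h ∈ Set.Icc (0 : ℝ) 1 := by
  unfold reachVal wordVal
  induction h.reverse with
  | nil => simp [listVal]
  | cons z l ih =>
    rw [listVal]
    by_cases h : z ∈ T
    · rw [ind_of_mem h, ind_compl_of_mem (Set.mem_union_left _ h)]
      norm_num
    rw [ind_of_notMem h, zero_add]
    by_cases h' : z ∈ Av
    · rw [ind_compl_of_mem (Set.mem_union_right _ h')]
      norm_num
    · rwa [ind_of_mem (show z ∈ (T ∪ Av)ᶜ from fun hz => hz.elim h h'), one_mul]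

lemma monotone_reachBy (T Av : Set Z) : Monotone (reachBy T Av) :=
  fun _ _ hnk _ ⟨m, hm, h⟩ => ⟨m, hm.trans_le hnk, h⟩

lemma tendsto_real_reachBy [MeasurableSpace Z] (μ : Measure (ℕ → Z)) [IsFiniteMeasure μ]
    (T Av : Set Z) :
    Filter.Tendsto (fun n => μ.real (reachBy T Av n)) Filter.atTop
      (nhds (μ.real (⋃ n, reachBy T Av n))) :=
  (ENNReal.tendsto_toReal (measure_ne_top _ _)).comp
    (tendsto_measure_iUnion_atTop (monotone_reachBy T Av))

variable [Fintype Z] [MeasurableSpace Z] [MeasurableSingletonClass Z]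

lemma measurableSet_reachBy (T Av : Set Z) (n : ℕ) : MeasurableSet (reachBy T Av n) := by
  have : reachBy T Av n = {ω | prefixWord n ω ∈ {h | reachVal T Av h = 1}} := by
    ext ω
    simp only [Set.mem_ofPred_eq, reachVal_prefixWord]
    unfold ind
    split_ifs with h <;> simp [h]
  rw [this]
  exact measurableSet_prefixWord n _

lemma real_reachBy_eq_sum (init : PMF Z) (step : Z → PMF Z) (T Av : Set Z) (n : ℕ) :
    (chainLaw init step).real (reachBy T Av n) =
      ∑ h ∈ words Z n, chainWeight init step h * reachVal T Av h := by
  rw [← integral_prefixWord]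
  simp_rw [reachVal_prefixWord]
  have : ind (reachBy T Av n) = (reachBy T Av n).indicator fun _ => 1 := by
    ext ω
    classical
    simp [ind, Set.indicator_apply]
  rw [this, integral_indicator_const _ (measurableSet_reachBy T Av n)]
  simp

/-- The probability of reaching `T` within the first `n` letters without visiting `Av` before,
from a given state. -/
def reachProb (step : Z → PMF Z) (T Av : Set Z) : ℕ → Z → ℝ :=
  chainVal step (ind T) (ind (T ∪ Av)ᶜ)

lemma real_reachBy (init : PMF Z) (step : Z → PMF Z) (T Av : Set Z) (n : ℕ) :
    (chainLaw init step).real (reachBy T Av n) =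
      ∑ z, (init z).toReal * reachProb step T Av n z :=
  (real_reachBy_eq_sum _ _ _ _ _).trans (sum_chainWeight_wordVal _ _ _ _ _)

end Reach

/-! ### Hitting times as first-step recursions -/

section Hitting

variable {Z : Type*}

/-- One plus the first time of a visit to `E`, which is `∞` if there is none. -/
def hitLen (E : Set Z) (ω : ℕ → Z) : ℝ≥0∞ := ⨅ t : ℕ, ⨅ _ : ω t ∈ E, ((t : ℝ≥0∞) + 1)

lemma hitLen_eq (E : Set Z) (ω : ℕ → Z) [Decidable (ω 0 ∈ E)] :
    hitLen E ω = if ω 0 ∈ E then 1 else 1 + hitLen E fun t => ω (t + 1) := by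
  unfold hitLen
  rw [← inf_iInf_nat_succ, ENNReal.add_iInf₂]
  split_ifs with h
  · simp only [h, iInf_pos, Nat.cast_zero, zero_add]
    refine inf_eq_left.2 (le_iInf₂ fun t _ => ?_)
    simp
  · simp only [h, iInf_false, top_inf_eq]
    refine iInf_congr fun t => iInf_congr fun _ => ?_
    push_cast
    ring

lemma wordVal_hit_nonneg (E : Set Z) (h : List Z) : 0 ≤ wordVal (fun _ => 1) (ind Eᶜ) h := by
  unfold wordVal
  induction h.reverse with
  | nil => simp [listVal]
  | cons z l ih => exact add_nonneg zero_le_one (mul_nonneg (ind_nonneg _ _) ih)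

lemma ofReal_wordVal_prefixWord (E : Set Z) (n : ℕ) (ω : ℕ → Z) :
    ENNReal.ofReal (wordVal (fun _ => 1) (ind Eᶜ) (prefixWord n ω)) = min (hitLen E ω) n := by
  classical
  induction n generalizing ω with
  | zero => simp [prefixWord]
  | succ n ih =>
    rw [prefixWord_succ_eq_append, wordVal_append, hitLen_eq,
      ENNReal.ofReal_add zero_le_one (mul_nonneg (ind_nonneg _ _) (wordVal_hit_nonneg _ _)),
      ENNReal.ofReal_mul (ind_nonneg _ _), ih]
    unfold ind
    by_cases h : ω 0 ∈ E
    · simp [h]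
    · simp only [Set.mem_compl_iff, h, not_false_eq_true, if_true, if_false, ENNReal.ofReal_one,
        one_mul, Nat.cast_add, Nat.cast_one]
      rw [add_comm (n : ℝ≥0∞) 1, min_add_add_left]

variable [Fintype Z] [MeasurableSpace Z] [MeasurableSingletonClass Z]

/-- Monotone convergence: the hitting time is the supremum of its truncations at `n`, and these
depend on finitely many letters. -/
lemma lintegral_hitLen (init : PMF Z) (step : Z → PMF Z) (E : Set Z) :
    ∫⁻ ω, hitLen E ω ∂chainLaw init step =
      ⨆ n, ENNReal.ofReal (∑ z, (init z).toReal * chainVal step (fun _ => 1) (ind Eᶜ) n z) := by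
  have hmeas (n : ℕ) : Measurable fun ω : ℕ → Z =>
      wordVal (fun _ => 1) (ind Eᶜ) (prefixWord n ω) :=
    (@measurable_from_top (List Z) ℝ _ (wordVal (fun _ => 1) (ind Eᶜ))).comp
      (measurable_prefixWord n)
  have hint (n : ℕ) : Integrable
      (fun ω : ℕ → Z => wordVal (fun _ => 1) (ind Eᶜ) (prefixWord n ω)) (chainLaw init step) := by
    refine Integrable.of_bound (hmeas n).aestronglyMeasurable n (Filter.Eventually.of_forall ?_)
    intro ω
    rw [Real.norm_of_nonneg (wordVal_hit_nonneg _ _), ← ENNReal.ofReal_le_ofReal_iff (by simp),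
      ofReal_wordVal_prefixWord]
    simp
  have hsup (ω : ℕ → Z) : hitLen E ω =
      ⨆ n, ENNReal.ofReal (wordVal (fun _ => 1) (ind Eᶜ) (prefixWord n ω)) := by
    simp_rw [ofReal_wordVal_prefixWord]
    rw [← inf_iSup_eq, ENNReal.iSup_natCast, inf_top_eq]
  simp_rw [hsup]
  rw [lintegral_iSup (fun n => (hmeas n).ennreal_ofReal) fun n k hnk ω => ?_]
  · refine iSup_congr fun n => ?_
    rw [← ofReal_integral_eq_lintegral_ofReal (hint n)
      (Filter.Eventually.of_forall fun ω => wordVal_hit_nonneg _ _), integral_prefixWord,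
      sum_chainWeight_wordVal]
  · simp only [ofReal_wordVal_prefixWord]
    exact min_le_min_left _ (by exact_mod_cast hnk)

end Hitting

/-! ### Finite Markov chains: reaching a target and the time this takes -/

section StateChain

variable {S : Type*} [Fintype S]

/-- The total `a s₀ + b s₀ * (a s₁ + b s₁ * …)` expected over `n` steps of the Markov chain with
transition probabilities `p`. -/
def stateVal (p : S → S → ℝ) (a b : S → ℝ) : ℕ → S → ℝ
  | 0, _ => 0
  | n + 1, s => a s + b s * ∑ s', p s s' * stateVal p a b n s'

/-- The probability of not visiting `E` in the first `n` states. -/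
def survival (p : S → S → ℝ) (E : Set S) : ℕ → S → ℝ
  | 0, _ => 1
  | n + 1, s => ind Eᶜ s * ∑ s', p s s' * survival p E n s'

variable {p : S → S → ℝ}

lemma stateVal_nonneg (hp : ∀ s s', 0 ≤ p s s') {a b : S → ℝ} (ha : ∀ s, 0 ≤ a s)
    (hb : ∀ s, 0 ≤ b s) (n : ℕ) (s : S) : 0 ≤ stateVal p a b n s := by
  induction n generalizing s with
  | zero => exact le_rfl
  | succ n ih =>
    exact add_nonneg (ha s) (mul_nonneg (hb s)
      (Finset.sum_nonneg fun s' _ => mul_nonneg (hp s s') (ih s')))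

lemma monotone_stateVal (hp : ∀ s s', 0 ≤ p s s') {a b : S → ℝ} (ha : ∀ s, 0 ≤ a s)
    (hb : ∀ s, 0 ≤ b s) (s : S) : Monotone fun n => stateVal p a b n s := by
  refine monotone_nat_of_le_succ fun n => ?_
  induction n generalizing s with
  | zero => exact stateVal_nonneg hp ha hb 1 s
  | succ n ih =>
    exact add_le_add_right (mul_le_mul_of_nonneg_left
      (Finset.sum_le_sum fun s' _ => mul_le_mul_of_nonneg_left (ih s') (hp s s')) (hb s)) _

/-- Jensen's inequality for the convex map `x ↦ l ^ x` under the probability weights `w s * v s / ∑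
w v`, that is, the law of the next state conditioned on success. -/
lemma weighted_jensen_rpow {l : ℝ} (hl0 : 0 < l) (hl1 : l ≤ 1) (w v t : S → ℝ)
    (hw : ∀ s, 0 ≤ w s) (hv : ∀ s, 0 ≤ v s) (ht : ∀ s, 0 ≤ t s) (hV : 0 < ∑ s, w s * v s) :
    (∑ s, w s * v s) * l ^ ((∑ s, w s * t s) / ∑ s, w s * v s) ≤
      ∑ s, w s * (v s * l ^ (t s / v s)) := by
  set V := ∑ s, w s * v s with hVdef
  have hlog : Real.log l ≤ 0 := Real.log_nonpos hl0.le hl1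
  have hj := convexOn_exp.map_sum_le (t := Finset.univ) (w := fun s => w s * v s / V)
    (p := fun s => Real.log l * (t s / v s))
    (fun s _ => div_nonneg (mul_nonneg (hw s) (hv s)) hV.le)
    (by rw [← Finset.sum_div, ← hVdef, div_self hV.ne']) (fun s _ => Set.mem_univ _)
  simp only [smul_eq_mul] at hj
  have hexp : l ^ ((∑ s, w s * t s) / V) ≤
      Real.exp (∑ s, w s * v s / V * (Real.log l * (t s / v s))) := by
    rw [Real.rpow_def_of_pos hl0, Real.exp_le_exp, Finset.sum_div, Finset.mul_sum]
    refine Finset.sum_le_sum fun s _ => ?_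
    -- Only an inequality, because `t s / 0 = 0`; since `l ≤ 1`, a smaller exponent goes the right
    -- way.
    have h1 : v s * (t s / v s) ≤ t s := by
      rcases eq_or_ne (v s) 0 with h | h
      · simp [h, ht s]
      · rw [mul_div_cancel₀ _ h]
    have h2 : w s * (v s * (t s / v s)) / V ≤ w s * t s / V := by
      have := hw s
      gcongr
    calc Real.log l * (w s * t s / V) ≤ Real.log l * (w s * (v s * (t s / v s)) / V) :=
          mul_le_mul_of_nonpos_left h2 hlog
      _ = w s * v s / V * (Real.log l * (t s / v s)) := by ring
  calc V * l ^ ((∑ s, w s * t s) / V)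
      ≤ V * ∑ s, w s * v s / V * Real.exp (Real.log l * (t s / v s)) := by
        gcongr
        exact hexp.trans hj
    _ = ∑ s, w s * (v s * l ^ (t s / v s)) := by
        rw [Finset.mul_sum]
        refine Finset.sum_congr rfl fun s _ => ?_
        rw [Real.rpow_def_of_pos hl0]
        field_simp

/-- The probability of reaching `T` within `n` states without visiting `Av` before. -/
abbrev stateReach (p : S → S → ℝ) (T Av : Set S) : ℕ → S → ℝ :=
  stateVal p (ind T) (ind (T ∪ Av)ᶜ)

/-- The expected number of states until `E` is visited, truncated at `n`. -/
abbrev stateLen (p : S → S → ℝ) (E : Set S) : ℕ → S → ℝ := stateVal p (fun _ => 1) (ind Eᶜ)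

/-- The expectation of `l` to the power of the number of states until `T` is reached, on the event
that this happens within `n` states and `Av` is not visited before. -/
abbrev stateDisc (p : S → S → ℝ) (l : ℝ) (T Av : Set S) : ℕ → S → ℝ :=
  stateVal p (fun s => l * ind T s) (fun s => l * ind (T ∪ Av)ᶜ s)

lemma stateReach_le_one (hp : ∀ s s', 0 ≤ p s s') (hp1 : ∀ s, ∑ s', p s s' = 1) (T Av : Set S)
    (n : ℕ) (s : S) : stateReach p T Av n s ≤ 1 := by
  induction n generalizing s with
  | zero => exact zero_le_one
  | succ n ih =>
    rw [stateReach, stateVal]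
    have h1 : ∑ s', p s s' * stateReach p T Av n s' ≤ 1 := by
      rw [← hp1 s]
      exact Finset.sum_le_sum fun s' _ => mul_le_of_le_one_right (hp s s') (ih s')
    by_cases h : s ∈ T
    · rw [ind_of_mem h, ind_compl_of_mem (Set.mem_union_left _ h)]
      simp
    · rw [ind_of_notMem h, zero_add]
      by_cases h' : s ∈ Av
      · rw [ind_compl_of_mem (Set.mem_union_right _ h')]
        simp
      · rwa [ind_of_mem (show s ∈ (T ∪ Av)ᶜ from fun hz => hz.elim h h'), one_mul]

/-- Jensen's inequality for the discount on the success event, carried out one step at a time. The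
length until `E` may be used because success before a visit to `T` is impossible from states of `E`
outside `T`. -/
lemma stateReach_mul_rpow_le (hp : ∀ s s', 0 ≤ p s s') (hp1 : ∀ s, ∑ s', p s s' = 1) {l : ℝ}
    (hl0 : 0 < l) (hl1 : l ≤ 1) {T Av E : Set S} (hTE : T ⊆ E)
    (hE : ∀ n, ∀ s ∈ E, s ∉ T → stateReach p T Av n s = 0) (n : ℕ) (s : S) :
    stateReach p T Av n s * l ^ (stateLen p E n s / stateReach p T Av n s) ≤
      stateDisc p l T Av n s := by
  have hdisc (n : ℕ) (s : S) : 0 ≤ stateDisc p l T Av n s :=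
    stateVal_nonneg hp (fun s => mul_nonneg hl0.le (ind_nonneg _ _))
      (fun s => mul_nonneg hl0.le (ind_nonneg _ _)) n s
  have hreach (n : ℕ) (s : S) : 0 ≤ stateReach p T Av n s :=
    stateVal_nonneg hp (ind_nonneg _) (ind_nonneg _) n s
  have hlen (n : ℕ) (s : S) : 0 ≤ stateLen p E n s :=
    stateVal_nonneg hp (fun _ => zero_le_one) (ind_nonneg _) n s
  induction n generalizing s with
  | zero =>
    change (0 : ℝ) * _ ≤ 0
    simp
  | succ n ih =>
    rcases (hreach (n + 1) s).eq_or_lt' with h0 | hpos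
    · rw [h0, zero_mul]
      exact hdisc _ _
    by_cases hT : s ∈ T
    · have h1 : stateReach p T Av (n + 1) s = 1 := by
        rw [stateReach, stateVal, ind_of_mem hT, ind_compl_of_mem (Set.mem_union_left _ hT)]
        simp
      have h2 : stateLen p E (n + 1) s = 1 := by
        rw [stateLen, stateVal, ind_compl_of_mem (hTE hT)]
        simp
      have h3 : stateDisc p l T Av (n + 1) s = l := by
        rw [stateDisc, stateVal, ind_of_mem hT, ind_compl_of_mem (Set.mem_union_left _ hT)]
        simp
      rw [h1, h2, h3]
      simp
    have hsE : s ∉ E := fun h => hpos.ne' (hE _ s h hT)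
    have hsA : s ∉ Av := by
      intro h
      refine hpos.ne' ?_
      rw [stateReach, stateVal, ind_of_notMem hT, ind_compl_of_mem (Set.mem_union_right _ h)]
      simp
    have hmem : s ∈ (T ∪ Av)ᶜ := fun hz => hz.elim hT hsA
    have h1 : stateReach p T Av (n + 1) s = ∑ s', p s s' * stateReach p T Av n s' := by
      rw [stateReach, stateVal, ind_of_notMem hT, ind_of_mem hmem]
      simp
    have h2 : stateLen p E (n + 1) s = 1 + ∑ s', p s s' * stateLen p E n s' := by
      rw [stateLen, stateVal, ind_of_mem (show s ∈ Eᶜ from hsE), one_mul]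
    have h3 : stateDisc p l T Av (n + 1) s = l * ∑ s', p s s' * stateDisc p l T Av n s' := by
      rw [stateDisc, stateVal, ind_of_notMem hT, ind_of_mem hmem]
      simp
    have hle1 := stateReach_le_one hp hp1 T Av (n + 1) s
    rw [h1] at hpos hle1
    rw [h1, h2, h3]
    set V := ∑ s', p s s' * stateReach p T Av n s'
    calc V * l ^ ((1 + ∑ s', p s s' * stateLen p E n s') / V)
        ≤ V * l ^ (1 + (∑ s', p s s' * stateLen p E n s') / V) := by
          refine mul_le_mul_of_nonneg_left ?_ hpos.le
          -- The current state costs `1 / V` in the exponent, which is at least `1` since `V` is a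
          -- probability; only one factor `l` is spent on it.
          refine Real.rpow_le_rpow_of_exponent_ge hl0 hl1 ?_
          rw [add_div]
          gcongr
          exact (one_le_div hpos).2 hle1
      _ = l * (V * l ^ ((∑ s', p s s' * stateLen p E n s') / V)) := by
          rw [Real.rpow_add hl0, Real.rpow_one]
          ring
      _ ≤ l * ∑ s', p s s' * (stateReach p T Av n s' *
            l ^ (stateLen p E n s' / stateReach p T Av n s')) :=
          mul_le_mul_of_nonneg_left (weighted_jensen_rpow hl0 hl1 _ _ _ (hp s) (hreach n)
            (hlen n) hpos) hl0.le
      _ ≤ l * ∑ s', p s s' * stateDisc p l T Av n s' := by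
          refine mul_le_mul_of_nonneg_left (Finset.sum_le_sum fun s' _ => ?_) hl0.le
          exact mul_le_mul_of_nonneg_left (ih s') (hp s s')

lemma survival_nonneg (hp : ∀ s s', 0 ≤ p s s') (E : Set S) (n : ℕ) (s : S) :
    0 ≤ survival p E n s := by
  induction n generalizing s with
  | zero => exact zero_le_one
  | succ n ih =>
    exact mul_nonneg (ind_nonneg _ _) (Finset.sum_nonneg fun s' _ => mul_nonneg (hp s s') (ih s'))

lemma antitone_survival (hp : ∀ s s', 0 ≤ p s s') (hp1 : ∀ s, ∑ s', p s s' = 1) (E : Set S)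
    (s : S) : Antitone fun n => survival p E n s := by
  refine antitone_nat_of_succ_le fun n => ?_
  induction n generalizing s with
  | zero =>
    simp only [survival, mul_one, hp1]
    unfold ind
    split_ifs <;> norm_num
  | succ n ih =>
    exact mul_le_mul_of_nonneg_left
      (Finset.sum_le_sum fun s' _ => mul_le_mul_of_nonneg_left (ih s') (hp s s')) (ind_nonneg _ _)

/-- Success visits `T ⊆ E`, so it excludes survival; the index `n + 1` lets a first step outside `E`
be taken without a separate initial case. -/
lemma survival_le_one_sub_stateReach (hp : ∀ s s', 0 ≤ p s s') (hp1 : ∀ s, ∑ s', p s s' = 1)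
    {T Av E : Set S} (hTE : T ⊆ E) (n : ℕ) (s : S) :
    survival p E (n + 1) s ≤ 1 - stateReach p T Av n s := by
  induction n generalizing s with
  | zero =>
    have := antitone_survival hp hp1 E s (Nat.zero_le 1)
    simpa [survival, stateVal] using this
  | succ n ih =>
    by_cases hE : s ∈ E
    · rw [survival, ind_compl_of_mem hE, zero_mul]
      linarith [stateReach_le_one hp hp1 T Av (n + 1) s]
    · have h1 : stateReach p T Av (n + 1) s ≤ ∑ s', p s s' * stateReach p T Av n s' := by
        rw [stateReach, stateVal, ind_of_notMem fun h => hE (hTE h), zero_add]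
        refine mul_le_of_le_one_left (Finset.sum_nonneg fun s' _ => mul_nonneg (hp s s')
          (stateVal_nonneg hp (ind_nonneg _) (ind_nonneg _) n s')) ?_
        unfold ind
        split_ifs <;> norm_num
      rw [survival, ind_of_mem (show s ∈ Eᶜ from hE), one_mul]
      calc ∑ s', p s s' * survival p E (n + 1) s'
          ≤ ∑ s', p s s' * (1 - stateReach p T Av n s') :=
            Finset.sum_le_sum fun s' _ => mul_le_mul_of_nonneg_left (ih s') (hp s s')
        _ = 1 - ∑ s', p s s' * stateReach p T Av n s' := by
            simp only [mul_sub, mul_one, Finset.sum_sub_distrib, hp1]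
        _ ≤ _ := by linarith

/-- The first `m` states contribute at most `m`; the remaining ones count only on survival, and then
contribute at most `K` on average. -/
lemma stateLen_add_le (hp : ∀ s s', 0 ≤ p s s') (hp1 : ∀ s, ∑ s', p s s' = 1) (E : Set S)
    {n : ℕ} {K : ℝ} (hK : ∀ s, stateLen p E n s ≤ K) (m : ℕ) (s : S) :
    stateLen p E (n + m) s ≤ m + survival p E m s * K := by
  induction m generalizing s with
  | zero => simpa [survival] using hK s
  | succ m ih =>
    have hm : (0 : ℝ) ≤ m := Nat.cast_nonneg m
    rw [← add_assoc, stateLen, stateVal, survival]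
    have h1 : ∑ s', p s s' * stateLen p E (n + m) s' ≤
        m + (∑ s', p s s' * survival p E m s') * K := by
      calc _ ≤ ∑ s', p s s' * (m + survival p E m s' * K) :=
            Finset.sum_le_sum fun s' _ => mul_le_mul_of_nonneg_left (ih s') (hp s s')
        _ = _ := by
            simp only [mul_add, Finset.sum_add_distrib, ← Finset.sum_mul, hp1, one_mul, ← mul_assoc]
    push_cast
    by_cases hE : s ∈ E
    · rw [ind_compl_of_mem hE]
      linarith
    · rw [ind_of_mem (show s ∈ Eᶜ from hE)]
      linarith

/-- By finiteness there are `N` and `r < 1` such that survival for `N` states has probability at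
most `r` from every state; the expected length is then bounded by a geometric series. -/
lemma exists_stateLen_le (hp : ∀ s s', 0 ≤ p s s') (hp1 : ∀ s, ∑ s', p s s' = 1)
    {T Av E : Set S} (hTE : T ⊆ E) (hE : ∀ s ∉ E, ∃ n, stateReach p T Av n s ≠ 0) :
    ∃ C, ∀ n s, stateLen p E n s ≤ C := by
  rcases isEmpty_or_nonempty S with hS | hS
  · exact ⟨0, fun n s => hS.elim s⟩
  have hlt (s : S) : ∃ n, survival p E n s < 1 := by
    by_cases hs : s ∈ E
    · refine ⟨1, ?_⟩
      rw [survival, ind_compl_of_mem hs]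
      simp
    · obtain ⟨n, hn⟩ := hE s hs
      have h0 : 0 ≤ stateReach p T Av n s :=
        stateVal_nonneg hp (ind_nonneg _) (ind_nonneg _) n s
      have h1 := survival_le_one_sub_stateReach hp hp1 (Av := Av) hTE n s
      exact ⟨n + 1, by linarith [lt_of_le_of_ne h0 hn.symm]⟩
  choose k hk using hlt
  set N := Finset.univ.sup k with hN
  obtain ⟨s₀, hs₀⟩ := Finite.exists_max fun s => survival p E N s
  set r := survival p E N s₀ with hr
  have hr1 : r < 1 := lt_of_le_of_lt
    (antitone_survival hp hp1 E s₀ (Finset.le_sup (Finset.mem_univ s₀))) (hk s₀)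
  have hr0 : 0 ≤ r := survival_nonneg hp E N s₀
  have hN1 : 1 ≤ N := by
    by_contra h
    have h0 : N = 0 := by omega
    rw [hr, h0] at hr1
    exact lt_irrefl _ hr1
  -- The fixed point of `K ↦ N + r * K`, so that the bound reproduces itself over each block of `N`
  -- steps.
  set C : ℝ := N / (1 - r) with hC
  have hCeq : N + r * C = C := by
    rw [hC]
    have : 1 - r ≠ 0 := by linarith
    field_simp
    ring
  have hC0 : 0 ≤ C := div_nonneg (Nat.cast_nonneg _) (by linarith)
  have hmult (j : ℕ) (s : S) : stateLen p E (j * N) s ≤ C := by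
    induction j generalizing s with
    | zero => simpa [stateVal] using hC0
    | succ j ih =>
      rw [add_one_mul]
      refine (stateLen_add_le hp hp1 E ih N s).trans ?_
      calc (N : ℝ) + survival p E N s * C ≤ N + r * C := by
            gcongr
            exact hs₀ s
        _ = C := hCeq
  refine ⟨C, fun n s => (monotone_stateVal hp (fun _ => zero_le_one) (ind_nonneg _) s ?_).trans
    (hmult n s)⟩
  exact Nat.le_mul_of_pos_right n hN1

end StateChain

/-! ### The discount bound for intermittent communication -/

section FiniteSums

variable {X Y : Type*} [Fintype X]

lemma PMF.bind_toReal (p : PMF X) (f : X → PMF Y) (y : Y) :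
    (p.bind f y).toReal = ∑ x, (p x).toReal * (f x y).toReal := by
  rw [PMF.bind_apply, tsum_fintype, ENNReal.toReal_sum fun x _ =>
    ENNReal.mul_ne_top (p.apply_ne_top x) ((f x).apply_ne_top y)]
  simp only [ENNReal.toReal_mul]

variable [Fintype Y]

lemma PMF.sum_bind_mul (p : PMF X) (f : X → PMF Y) (F : Y → ℝ) :
    ∑ y, (p.bind f y).toReal * F y = ∑ x, (p x).toReal * ∑ y, (f x y).toReal * F y := by
  simp only [PMF.bind_toReal, Finset.sum_mul, Finset.mul_sum]
  rw [Finset.sum_comm]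
  simp only [mul_assoc]

lemma PMF.sum_pure_mul (x : X) (F : X → ℝ) : ∑ y, (PMF.pure x y).toReal * F y = F x := by
  classical
  rw [Finset.sum_eq_single x]
  · simp
  · intro y _ hy
    simp [PMF.pure_apply, hy]
  · simp

lemma PMF.sum_map_mul (p : PMF X) (f : X → Y) (F : Y → ℝ) :
    ∑ y, (p.map f y).toReal * F y = ∑ x, (p x).toReal * F (f x) := by
  rw [← PMF.bind_pure_comp, PMF.sum_bind_mul]
  simp only [Function.comp_apply, PMF.sum_pure_mul]

lemma sum_commFlip_mul (q : unitInterval) (F : Bool → ℝ) :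
    ∑ b, (commFlip q b).toReal * F b = (1 - (q : ℝ)) * F true + q * F false := by
  have h1 : 0 ≤ 1 - (q : ℝ) := sub_nonneg.2 q.2.2
  simp [commFlip, PMF.ofFintype_apply, ENNReal.toReal_ofReal h1, ENNReal.toReal_ofReal q.2.1]

end FiniteSums

section Discount

lemma reachAvoid_eq_iUnion {ι : Type*} {S A : ι → Type*} (T Av : Set (Joint S)) :
    (reachAvoid T Av : Set (JointPath S A)) =
      ⋃ n, reachBy (Prod.fst ⁻¹' T) (Prod.fst ⁻¹' Av) n := by
  ext ω
  simp only [Set.mem_iUnion]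
  exact ⟨fun ⟨m, h⟩ => ⟨m + 1, m, m.lt_succ_self, h⟩, fun ⟨_, m, _, h⟩ => ⟨m, h⟩⟩

variable {ι : Type*} [Fintype ι] [DecidableEq ι] {S A : ι → Type*} [∀ i, Fintype (S i)]
  [∀ i, Fintype (A i)]

/-- One step of the execution under full communication. -/
def fullStep (M : ∀ i, MDP (S i) (A i)) (π : Joint S → PMF (Joint A))
    (z : Joint S × Joint A) : PMF (Joint S × Joint A) :=
  (jointTrans M z.1 z.2).bind (actFull π)

/-- The transition probabilities between joint states under full communication. -/
def stateTrans (M : ∀ i, MDP (S i) (A i)) (π : Joint S → PMF (Joint A)) (s s' : Joint S) : ℝ :=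
  ∑ a, (π s a).toReal * (jointTrans M s a s').toReal

lemma stateTrans_nonneg (M : ∀ i, MDP (S i) (A i)) (π : Joint S → PMF (Joint A))
    (s s' : Joint S) : 0 ≤ stateTrans M π s s' :=
  Finset.sum_nonneg fun _ _ => mul_nonneg ENNReal.toReal_nonneg ENNReal.toReal_nonneg

lemma sum_stateTrans_mul (M : ∀ i, MDP (S i) (A i)) (π : Joint S → PMF (Joint A))
    (s : Joint S) (F : Joint S → ℝ) :
    ∑ s', stateTrans M π s s' * F s' =
      ∑ a, (π s a).toReal * ∑ s', (jointTrans M s a s').toReal * F s' := by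
  simp only [stateTrans, Finset.sum_mul, Finset.mul_sum, mul_assoc]
  exact Finset.sum_comm

lemma sum_stateTrans (M : ∀ i, MDP (S i) (A i)) (π : Joint S → PMF (Joint A)) (s : Joint S) :
    ∑ s', stateTrans M π s s' = 1 := by
  have := sum_stateTrans_mul M π s fun _ => 1
  simpa [PMF.sum_toReal] using this

/-- When the coefficients depend on the state only, averaging out the actions reduces the chain of
state-action pairs to the chain of states. -/
lemma sum_actFull_chainVal (M : ∀ i, MDP (S i) (A i)) (π : Joint S → PMF (Joint A))
    (a b : Joint S → ℝ) (n : ℕ) (s : Joint S) :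
    ∑ z, (actFull π s z).toReal *
        chainVal (fullStep M π) (fun z => a z.1) (fun z => b z.1) n z =
      stateVal (stateTrans M π) a b n s := by
  induction n generalizing s with
  | zero => simp [chainVal, stateVal]
  | succ n ih =>
    simp only [chainVal, stateVal, fullStep]
    simp only [PMF.sum_bind_mul]
    change ∑ z, (actFull π s z).toReal * (a z.1 + b z.1 *
      ∑ s', (jointTrans M z.1 z.2 s').toReal * ∑ z', (actFull π s' z').toReal *
        chainVal (fullStep M π) (fun z => a z.1) (fun z => b z.1) n z') = _
    simp only [ih]
    rw [actFull, PMF.sum_map_mul, sum_stateTrans_mul]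
    simp only [mul_add, Finset.sum_add_distrib, ← Finset.sum_mul, PMF.sum_toReal, one_mul,
      Finset.mul_sum]
    congr 1
    exact Finset.sum_congr rfl fun x _ => Finset.sum_congr rfl fun s' _ => by ring

/-- The branch without communication is dropped. -/
lemma le_sum_act_mul (π : Joint S → PMF (Joint A)) (q : unitInterval) (s : Joint S)
    (imagine : ι → PMF (Joint S)) {F : Config S A → ℝ} (hF : ∀ c, 0 ≤ F c) :
    (1 - (q : ℝ)) * ∑ a, (π s a).toReal * F (true, fun _ => (s, a)) ≤
      ∑ c, (act π q s imagine c).toReal * F c := by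
  rw [act, PMF.sum_bind_mul, sum_commFlip_mul, if_pos rfl, PMF.sum_map_mul]
  exact le_add_of_nonneg_right (mul_nonneg q.2.1
    (Finset.sum_nonneg fun c _ => mul_nonneg ENNReal.toReal_nonneg (hF c)))

lemma reachProb_nonneg {Z : Type*} [Fintype Z] (step : Z → PMF Z) (T Av : Set Z) (n : ℕ) (z : Z) :
    0 ≤ reachProb step T Av n z := by
  induction n generalizing z with
  | zero => exact le_rfl
  | succ n ih =>
    exact add_nonneg (ind_nonneg _ _) (mul_nonneg (ind_nonneg _ _)
      (Finset.sum_nonneg fun z' _ => mul_nonneg ENNReal.toReal_nonneg (ih z')))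

/-- Only the runs with communication at every time up to the arrival in `T` are kept. There all
agents hold the true state and the common action, so the true state moves as under full
communication. Each time costs a factor `1 - q`, including the time of arrival. -/
lemma stateDisc_le_reachProb (M : ∀ i, MDP (S i) (A i)) (π : Joint S → PMF (Joint A))
    (T Av : Set (Joint S)) (q : unitInterval) (n : ℕ) (s : Joint S) :
    stateDisc (stateTrans M π) (1 - (q : ℝ)) T Av n s ≤
      (1 - (q : ℝ)) * ∑ a, (π s a).toReal * reachProb (intStep M π q)
        {c | (actual c).1 ∈ T} {c | (actual c).1 ∈ Av} n (true, fun _ => (s, a)) := by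
  have hq : 0 ≤ 1 - (q : ℝ) := sub_nonneg.2 q.2.2
  induction n generalizing s with
  | zero => simp [stateVal, reachProb, chainVal]
  | succ n ih =>
    have hstep (a : Joint A) :
        ∑ s', (jointTrans M s a s').toReal * stateDisc (stateTrans M π) (1 - (q : ℝ)) T Av n s' ≤
        ∑ c', (intStep M π q (true, fun _ => (s, a)) c').toReal * reachProb (intStep M π q)
          {c | (actual c).1 ∈ T} {c | (actual c).1 ∈ Av} n c' := by
      rw [intStep, PMF.sum_bind_mul]
      refine Finset.sum_le_sum fun s' _ => mul_le_mul_of_nonneg_left ?_ ENNReal.toReal_nonneg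
      exact (ih s').trans (le_sum_act_mul π q s' _ (reachProb_nonneg _ _ _ n))
    calc stateDisc (stateTrans M π) (1 - (q : ℝ)) T Av (n + 1) s
        = (1 - (q : ℝ)) * ∑ a, (π s a).toReal * (ind T s + ind (T ∪ Av)ᶜ s *
          ∑ s', (jointTrans M s a s').toReal *
            stateDisc (stateTrans M π) (1 - (q : ℝ)) T Av n s') := by
          rw [stateDisc, stateVal, sum_stateTrans_mul]
          simp only [mul_add, Finset.sum_add_distrib, ← Finset.sum_mul, PMF.sum_toReal, one_mul,
            Finset.mul_sum]
          congr 1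
          exact Finset.sum_congr rfl fun x _ => Finset.sum_congr rfl fun s' _ => by ring
      _ ≤ _ := by
          refine mul_le_mul_of_nonneg_left (Finset.sum_le_sum fun a _ => ?_) hq
          refine mul_le_mul_of_nonneg_left ?_ ENNReal.toReal_nonneg
          exact add_le_add_right (mul_le_mul_of_nonneg_left (hstep a) (ind_nonneg _ _)) _

variable [∀ i, MeasurableSpace (S i)] [∀ i, MeasurableSingletonClass (S i)]
  [∀ i, MeasurableSpace (A i)] [∀ i, MeasurableSingletonClass (A i)]

lemma real_fullLaw_reachBy (M : ∀ i, MDP (S i) (A i)) (π : Joint S → PMF (Joint A))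
    (T Av : Set (Joint S)) (s : Joint S) (n : ℕ) :
    (fullLaw M π s).real (reachBy (Prod.fst ⁻¹' T) (Prod.fst ⁻¹' Av) n) =
      stateReach (stateTrans M π) T Av n s := by
  rw [stateReach, ← sum_actFull_chainVal]
  exact real_reachBy _ _ _ _ _

lemma tendsto_stateReach (M : ∀ i, MDP (S i) (A i)) (π : Joint S → PMF (Joint A))
    (T Av : Set (Joint S)) (s : Joint S) :
    Filter.Tendsto (fun n => stateReach (stateTrans M π) T Av n s) Filter.atTop
      (nhds ((fullLaw M π s).real (reachAvoid T Av))) := by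
  simp only [← real_fullLaw_reachBy, reachAvoid_eq_iUnion]
  exact tendsto_real_reachBy _ _ _

lemma stateReach_le_real (M : ∀ i, MDP (S i) (A i)) (π : Joint S → PMF (Joint A))
    (T Av : Set (Joint S)) (s : Joint S) (n : ℕ) :
    stateReach (stateTrans M π) T Av n s ≤ (fullLaw M π s).real (reachAvoid T Av) := by
  rw [← real_fullLaw_reachBy, reachAvoid_eq_iUnion]
  exact measureReal_mono (Set.subset_iUnion _ n)

lemma stateReach_eq_zero_of_mem_deadStates (M : ∀ i, MDP (S i) (A i))
    (π : Joint S → PMF (Joint A)) (T Av : Set (Joint S)) {s : Joint S}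
    (hs : s ∈ deadStates M π T Av) (n : ℕ) : stateReach (stateTrans M π) T Av n s = 0 := by
  refine le_antisymm ((stateReach_le_real M π T Av s n).trans_eq ?_)
    (stateVal_nonneg (stateTrans_nonneg M π) (ind_nonneg _) (ind_nonneg _) n s)
  have hs' : fullLaw M π s (reachAvoid T Av) = 0 := hs
  rw [measureReal_def, hs', ENNReal.toReal_zero]

lemma exists_stateReach_ne_zero (M : ∀ i, MDP (S i) (A i)) (π : Joint S → PMF (Joint A))
    (T Av : Set (Joint S)) {s : Joint S} (hs : s ∉ deadStates M π T Av) :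
    ∃ n, stateReach (stateTrans M π) T Av n s ≠ 0 := by
  by_contra! h
  have h1 := tendsto_stateReach M π T Av s
  simp only [h] at h1
  have h2 := tendsto_nhds_unique h1 tendsto_const_nhds
  rw [measureReal_eq_zero_iff] at h2
  exact hs h2

lemma expLen_eq_iSup (M : ∀ i, MDP (S i) (A i)) (π : Joint S → PMF (Joint A))
    (T Av : Set (Joint S)) : expLen M π T Av =
      ⨆ n, ENNReal.ofReal
        (stateLen (stateTrans M π) (T ∪ deadStates M π T Av) n (initState M)) := by
  simp only [stateLen, ← sum_actFull_chainVal]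
  exact lintegral_hitLen (actFull π (initState M)) (fullStep M π)
    (Prod.fst ⁻¹' (T ∪ deadStates M π T Av))

theorem expLen_ne_top (M : ∀ i, MDP (S i) (A i)) (π : Joint S → PMF (Joint A))
    (T Av : Set (Joint S)) : expLen M π T Av ≠ ∞ := by
  obtain ⟨C, hC⟩ := exists_stateLen_le (stateTrans_nonneg M π) (sum_stateTrans M π)
    (T := T) (Av := Av) (E := T ∪ deadStates M π T Av) Set.subset_union_left fun s hs =>
      exists_stateReach_ne_zero M π T Av fun h => hs (Or.inr h)
  rw [expLen_eq_iSup]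
  exact ne_top_of_le_ne_top ENNReal.ofReal_ne_top
    (iSup_le fun n => ENNReal.ofReal_le_ofReal (hC n (initState M)))

lemma stateLen_le_expLen (M : ∀ i, MDP (S i) (A i)) (π : Joint S → PMF (Joint A))
    (T Av : Set (Joint S)) (n : ℕ) :
    stateLen (stateTrans M π) (T ∪ deadStates M π T Av) n (initState M) ≤
      (expLen M π T Av).toReal := by
  rw [← ENNReal.ofReal_le_iff_le_toReal (expLen_ne_top M π T Av), expLen_eq_iSup]
  exact le_iSup (fun n => ENNReal.ofReal
    (stateLen (stateTrans M π) (T ∪ deadStates M π T Av) n (initState M))) n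

lemma valueInt_eq (M : ∀ i, MDP (S i) (A i)) (π : Joint S → PMF (Joint A))
    (T Av : Set (Joint S)) (q : unitInterval) : valueInt M π T Av q =
      (chainLaw (intInit M π q) (intStep M π q)).real
        (⋃ n, reachBy {c | (actual c).1 ∈ T} {c | (actual c).1 ∈ Av} n) := by
  have hm : Measurable fun (c : ℕ → Config S A) t => actual (c t) :=
    measurable_pi_lambda _ fun t =>
      (measurable_of_countable (actual : Config S A → _)).comp (measurable_pi_apply t)
  rw [valueInt, intLaw, reachAvoid_eq_iUnion, map_measureReal_apply hm
    (MeasurableSet.iUnion fun n => measurableSet_reachBy _ _ n), Set.preimage_iUnion]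
  rfl

lemma stateDisc_le_valueInt (M : ∀ i, MDP (S i) (A i)) (π : Joint S → PMF (Joint A))
    (T Av : Set (Joint S)) (q : unitInterval) (n : ℕ) :
    stateDisc (stateTrans M π) (1 - (q : ℝ)) T Av n (initState M) ≤ valueInt M π T Av q := by
  rw [valueInt_eq]
  calc _ ≤ _ := stateDisc_le_reachProb M π T Av q n (initState M)
    _ ≤ _ := le_sum_act_mul π q (initState M) (fun _ => PMF.pure (initState M))
      (reachProb_nonneg _ _ _ n)
    _ = _ := (real_reachBy (intInit M π q) (intStep M π q) _ _ n).symm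
    _ ≤ _ := measureReal_mono (Set.subset_iUnion _ n)

theorem valueFull_mul_rpow_le_valueInt (M : ∀ i, MDP (S i) (A i)) (π : Joint S → PMF (Joint A))
    (T Av : Set (Joint S)) (q : unitInterval) :
    valueFull M π T Av * (1 - (q : ℝ)) ^ ((expLen M π T Av).toReal / valueFull M π T Av) ≤
      valueInt M π T Av q := by
  have hl1 : 1 - (q : ℝ) ≤ 1 := by linarith [q.2.1]
  -- Positivity of the exponent, which makes the power vanish when `q = 1`.
  have hlen : 1 ≤ (expLen M π T Av).toReal := by
    have := stateLen_le_expLen M π T Av 1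
    simpa [stateVal] using this
  have hv0 : 0 ≤ valueFull M π T Av := measureReal_nonneg
  have hi0 : 0 ≤ valueInt M π T Av q := measureReal_nonneg
  rcases hv0.eq_or_lt' with hv | hv
  · rw [hv, zero_mul]
    exact hi0
  rcases (sub_nonneg.2 q.2.2 : 0 ≤ 1 - (q : ℝ)).eq_or_lt' with hl | hl0
  · rw [hl, Real.zero_rpow (by positivity), mul_zero]
    exact hi0
  have htend := tendsto_stateReach M π T Av (initState M)
  -- The length in the exponent is already the full one; the truncated length is smaller, which only
  -- helps since the base is at most `1`.
  have hlim : Filter.Tendsto (fun n => stateReach (stateTrans M π) T Av n (initState M) *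
      (1 - (q : ℝ)) ^ ((expLen M π T Av).toReal /
        stateReach (stateTrans M π) T Av n (initState M))) Filter.atTop
      (nhds (valueFull M π T Av *
        (1 - (q : ℝ)) ^ ((expLen M π T Av).toReal / valueFull M π T Av))) :=
    htend.mul (Filter.Tendsto.rpow tendsto_const_nhds (tendsto_const_nhds.div htend hv.ne')
      (Or.inl hl0.ne'))
  refine le_of_tendsto' hlim fun n => ?_
  have hr0 : 0 ≤ stateReach (stateTrans M π) T Av n (initState M) :=
    stateVal_nonneg (stateTrans_nonneg M π) (ind_nonneg _) (ind_nonneg _) n _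
  refine le_trans ?_ (stateDisc_le_valueInt M π T Av q n)
  refine le_trans ?_ (stateReach_mul_rpow_le (stateTrans_nonneg M π) (sum_stateTrans M π) hl0 hl1
    (E := T ∪ deadStates M π T Av) Set.subset_union_left (fun k s hs hT =>
      stateReach_eq_zero_of_mem_deadStates M π T Av (hs.resolve_left hT) k) n (initState M))
  refine mul_le_mul_of_nonneg_left (Real.rpow_le_rpow_of_exponent_ge hl0 hl1 ?_) hr0
  exact div_le_div_of_nonneg_right (stateLen_le_expLen M π T Av n) hr0

end Discount

/-! ### Filtering a Markov chain that is observed partially, and sometimes fully -/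

section Filter

variable {Z X : Type*}

/-- The observation of a state with a flag that tells whether it is observed fully. -/
def mask (pr : Z → X) (y : Bool × Z) : X ⊕ Z := if y.1 then Sum.inr y.2 else Sum.inl (pr y.2)

/-- The last state of a word of flagged states. -/
def lastState (h : List (Bool × Z)) : Option Z := (h.map Prod.snd).head?

/-- The weight of a word of states. -/
def pathWeight (κ : Option Z → Z → ℝ) : List Z → ℝ := weight fun h z => κ h.head? z

/-- The weight of a word of states with independent flags. -/
def flagWeight (κ : Option Z → Z → ℝ) (w : Bool → ℝ) : List (Bool × Z) → ℝ :=
  weight fun h y => w y.1 * κ (lastState h) y.2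

variable {κ : Option Z → Z → ℝ} {pr : Z → X} {w : Bool → ℝ}

lemma flagWeight_nonneg (hκ : ∀ c z, 0 ≤ κ c z) (hw : ∀ b, 0 ≤ w b) (h : List (Bool × Z)) :
    0 ≤ flagWeight κ w h := weight_nonneg (fun _ _ => mul_nonneg (hw _) (hκ _ _)) h

lemma pathWeight_ne_zero_of_flagWeight {h : List (Bool × Z)} (hh : flagWeight κ w h ≠ 0) :
    pathWeight κ (h.map Prod.snd) ≠ 0 := by
  induction h with
  | nil => simp [pathWeight, weight]
  | cons y h ih =>
    simp only [flagWeight, weight, ne_eq, mul_eq_zero, not_or] at hh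
    exact mul_ne_zero (ih hh.1) hh.2.2

/-- The observations of a word of states none of which is observed fully. -/
def blind (pr : Z → X) (h : List Z) : List (X ⊕ Z) := h.map fun z => Sum.inl (pr z)

lemma blind_eq_map_mask (h : List (Bool × Z)) :
    blind pr (h.map Prod.snd) = (h.map fun y => (false, y.2)).map (mask pr) := by
  simp [blind, mask]

lemma blind_eq_map_map_mask (h : List (Bool × Z)) :
    blind pr (h.map Prod.snd) =
      (h.map (mask pr)).map (Sum.elim Sum.inl fun z => Sum.inl (pr z)) := by
  simp only [blind, List.map_map]
  refine List.map_congr_left fun y _ => ?_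
  rcases y with ⟨_ | _, x⟩ <;> rfl

variable [Fintype Z]

open Classical in
/-- The conditional law of the present state given the past observations: `Sum.inr x` is the
observation of the state `x` itself, and `Sum.inl y` the observation of its image `y` under `pr`. -/
def belief (κ : Option Z → Z → ℝ) (pr : Z → X) : List (X ⊕ Z) → Option Z → ℝ
  | [], c => if c = none then 1 else 0
  | Sum.inr x :: _, c => if c = some x then 1 else 0
  | Sum.inl _ :: _, none => 0
  | Sum.inl y :: o, some z =>
    if pr z = y then (∑ c, belief κ pr o c * κ c z) /
      ∑ x, if pr x = y then ∑ c, belief κ pr o c * κ c x else 0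
    else 0

/-- The conditional law of the next state given the past observations. -/
def predict (κ : Option Z → Z → ℝ) (pr : Z → X) (o : List (X ⊕ Z)) (z : Z) : ℝ :=
  ∑ c, belief κ pr o c * κ c z

open Classical in
/-- The conditional law of the image of the next state given the past observations. -/
def predictObs (κ : Option Z → Z → ℝ) (pr : Z → X) (o : List (X ⊕ Z)) (y : X) : ℝ :=
  ∑ z, if pr z = y then predict κ pr o z else 0

lemma sum_flagWeight_succ (n : ℕ) (F : List (Bool × Z) → ℝ) :
    ∑ h ∈ words (Bool × Z) (n + 1), flagWeight κ w h * F h =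
      ∑ h ∈ words (Bool × Z) n, flagWeight κ w h *
        (w true * ∑ x, κ (lastState h) x * F ((true, x) :: h) +
          w false * ∑ x, κ (lastState h) x * F ((false, x) :: h)) := by
  rw [sum_words_succ]
  refine Finset.sum_congr rfl fun h _ => ?_
  rw [Fintype.sum_prod_type, Fintype.sum_bool, mul_add]
  simp only [flagWeight, weight, Finset.mul_sum]
  congr 1 <;> exact Finset.sum_congr rfl fun x _ => by ring

/-- The flags are independent of the path, so they sum out. -/
lemma sum_flagWeight_map_snd (hw1 : w true + w false = 1) (n : ℕ) (F : List Z → ℝ) :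
    ∑ h ∈ words (Bool × Z) n, flagWeight κ w h * F (h.map Prod.snd) =
      ∑ h ∈ words Z n, pathWeight κ h * F h := by
  induction n generalizing F with
  | zero => simp [flagWeight, pathWeight, weight]
  | succ n ih =>
    rw [sum_flagWeight_succ, sum_words_succ]
    simp only [List.map_cons, ← add_mul, hw1, one_mul]
    have h1 := ih fun h => ∑ x, κ h.head? x * F (x :: h)
    simp only [lastState]
    rw [h1]
    refine Finset.sum_congr rfl fun h _ => ?_
    rw [Finset.mul_sum]
    exact Finset.sum_congr rfl fun x _ => by simp only [pathWeight, weight]; ring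

lemma sum_flagWeight (hκ1 : ∀ c, ∑ z, κ c z = 1) (hw1 : w true + w false = 1) (n : ℕ) :
    ∑ h ∈ words (Bool × Z) n, flagWeight κ w h = 1 := by
  have := sum_flagWeight_map_snd (κ := κ) hw1 n fun _ => 1
  simp only [mul_one] at this
  rw [this]
  exact sum_weight_eq_one (fun h => hκ1 _) n

lemma belief_nonneg (hκ : ∀ c z, 0 ≤ κ c z) (o : List (X ⊕ Z)) (c : Option Z) :
    0 ≤ belief κ pr o c := by
  classical
  induction o generalizing c with
  | nil => unfold belief; split_ifs <;> norm_num
  | cons y o ih =>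
    have h (z : Z) : 0 ≤ ∑ c, belief κ pr o c * κ c z :=
      Finset.sum_nonneg fun c _ => mul_nonneg (ih c) (hκ c z)
    rcases y with y | x
    · rcases c with _ | z
      · exact le_rfl
      · unfold belief
        split_ifs
        · refine div_nonneg (h z) (Finset.sum_nonneg fun x _ => ?_)
          split_ifs
          · exact h x
          · exact le_rfl
        · exact le_rfl
    · unfold belief; split_ifs <;> norm_num

lemma predict_nonneg (hκ : ∀ c z, 0 ≤ κ c z) (o : List (X ⊕ Z)) (z : Z) : 0 ≤ predict κ pr o z :=
  Finset.sum_nonneg fun c _ => mul_nonneg (belief_nonneg hκ o c) (hκ c z)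

lemma predictObs_nonneg (hκ : ∀ c z, 0 ≤ κ c z) (o : List (X ⊕ Z)) (y : X) :
    0 ≤ predictObs κ pr o y := by
  refine Finset.sum_nonneg fun z _ => ?_
  split_ifs
  · exact predict_nonneg hκ o z
  · exact le_rfl

lemma predict_le_predictObs (hκ : ∀ c z, 0 ≤ κ c z) (o : List (X ⊕ Z)) (z : Z) :
    predict κ pr o z ≤ predictObs κ pr o (pr z) := by
  classical
  have h := Finset.single_le_sum (f := fun x => if pr x = pr z then predict κ pr o x else 0)
    (fun x _ => by
      split_ifs
      · exact predict_nonneg hκ o x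
      · exact le_rfl) (Finset.mem_univ z)
  rw [if_pos rfl] at h
  unfold predictObs
  convert h

open Classical in
lemma belief_inl_some (o : List (X ⊕ Z)) (y : X) (z : Z) :
    belief κ pr (Sum.inl y :: o) (some z) =
      if pr z = y then predict κ pr o z / predictObs κ pr o y else 0 := rfl

-- Bayes' rule in multiplied form. It survives a vanishing denominator, since then the prediction of
-- each compatible state vanishes too.
open Classical in
lemma predictObs_mul_belief (hκ : ∀ c z, 0 ≤ κ c z) (o : List (X ⊕ Z)) (y : X) (z : Z) :
    predictObs κ pr o y * belief κ pr (Sum.inl y :: o) (some z) =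
      if pr z = y then predict κ pr o z else 0 := by
  rw [belief_inl_some]
  split_ifs with h
  · rcases eq_or_ne (predictObs κ pr o y) 0 with h0 | h0
    · have h1 := predict_le_predictObs (pr := pr) hκ o z
      rw [h, h0] at h1
      rw [h0, zero_mul, le_antisymm h1 (predict_nonneg hκ o z)]
    · exact mul_div_cancel₀ _ h0
  · exact mul_zero _

lemma sum_belief_mul_sum (o : List (X ⊕ Z)) (F : Z → ℝ) :
    ∑ c, belief κ pr o c * ∑ z, κ c z * F z = ∑ z, predict κ pr o z * F z := by
  simp only [predict, Finset.mul_sum, Finset.sum_mul, ← mul_assoc]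
  exact Finset.sum_comm

lemma sum_predict (hκ1 : ∀ c, ∑ z, κ c z = 1) (o : List (X ⊕ Z)) :
    ∑ z, predict κ pr o z = ∑ c, belief κ pr o c := by
  have h := sum_belief_mul_sum (κ := κ) (pr := pr) o fun _ => 1
  simpa [hκ1] using h.symm

lemma sum_belief_inl (o : List (X ⊕ Z)) (y : X) :
    ∑ c, belief κ pr (Sum.inl y :: o) c = predictObs κ pr o y / predictObs κ pr o y := by
  classical
  rw [Fintype.sum_option]
  simp only [belief_inl_some]
  change (0 : ℝ) + _ = _
  rw [zero_add]
  conv_rhs => rw [predictObs, Finset.sum_div]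
  exact Finset.sum_congr rfl fun z _ => by split_ifs <;> simp [predictObs]

/-- Equality can fail: after an observation of predicted weight zero the belief is identically zero
by `0 / 0 = 0`. -/
lemma sum_belief_le_one (o : List (X ⊕ Z)) : ∑ c, belief κ pr o c ≤ 1 := by
  classical
  rcases o with _ | ⟨y | x, o⟩
  · simp [belief]
  · rw [sum_belief_inl]
    exact div_self_le_one _
  · simp only [belief, Finset.sum_ite_eq', Finset.mem_univ, if_true, le_refl]

/-- The filter never excludes what actually happened; this keeps the predictions inside the later
logarithms positive. -/
lemma belief_lastState_pos (hκ : ∀ c z, 0 ≤ κ c z) {h : List (Bool × Z)}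
    (hh : pathWeight κ (h.map Prod.snd) ≠ 0) :
    0 < belief κ pr (h.map (mask pr)) (lastState h) := by
  classical
  induction h with
  | nil => simp [belief, lastState]
  | cons y h ih =>
    obtain ⟨b, x⟩ := y
    simp only [List.map_cons, pathWeight, weight, ne_eq, mul_eq_zero, not_or] at hh
    have hpred : 0 < predict κ pr (h.map (mask pr)) x := by
      refine lt_of_lt_of_le (mul_pos (ih hh.1) (lt_of_le_of_ne (hκ _ x) (Ne.symm hh.2))) ?_
      exact Finset.single_le_sum (f := fun c => belief κ pr (h.map (mask pr)) c * κ c x)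
        (fun c _ => mul_nonneg (belief_nonneg hκ _ c) (hκ c x)) (Finset.mem_univ _)
    cases b
    · change 0 < belief κ pr (Sum.inl (pr x) :: h.map (mask pr)) (some x)
      rw [belief_inl_some, if_pos rfl]
      exact div_pos hpred (hpred.trans_le (predict_le_predictObs hκ _ x))
    · change 0 < belief κ pr (Sum.inr x :: h.map (mask pr)) (some x)
      simp [belief]

lemma predictObs_pos (hκ : ∀ c z, 0 ≤ κ c z) {h : List (Bool × Z)} {x : Z}
    (hh : pathWeight κ (h.map Prod.snd) ≠ 0) (hx : κ (lastState h) x ≠ 0) :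
    0 < predictObs κ pr (h.map (mask pr)) (pr x) := by
  refine lt_of_lt_of_le (mul_pos (belief_lastState_pos (pr := pr) hκ hh)
    (lt_of_le_of_ne (hκ _ x) hx.symm)) (le_trans (b := predict κ pr (h.map (mask pr)) x) ?_
    (predict_le_predictObs hκ _ x))
  exact Finset.single_le_sum (f := fun c => belief κ pr (h.map (mask pr)) c * κ c x)
    (fun c _ => mul_nonneg (belief_nonneg hκ _ c) (hκ c x)) (Finset.mem_univ _)

lemma predictObs_blind_pos (hκ : ∀ c z, 0 ≤ κ c z) {h : List Z} {x : Z}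
    (hh : pathWeight κ h ≠ 0) (hx : κ h.head? x ≠ 0) :
    0 < predictObs κ pr (blind pr h) (pr x) := by
  have hs : (h.map fun z => (false, z)).map Prod.snd = h := by simp
  have h1 := predictObs_pos (pr := pr) hκ (h := h.map fun z => (false, z)) (x := x)
    (by rwa [hs]) (by rwa [lastState, hs])
  have h2 := blind_eq_map_mask (pr := pr) (h.map fun z => (false, z))
  rw [hs] at h2
  have h3 : ((h.map fun z => (false, z)).map fun y => (false, y.2)) =
      h.map fun z => (false, z) := by simp
  rwa [h2, h3]

variable [Fintype X]

lemma sum_predict_mul (o : List (X ⊕ Z)) (g : X → ℝ) :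
    ∑ z, predict κ pr o z * g (pr z) = ∑ y, predictObs κ pr o y * g y := by
  classical
  simp only [predictObs, Finset.sum_mul, ite_mul, zero_mul]
  rw [Finset.sum_comm]
  simp

lemma sum_predictObs (o : List (X ⊕ Z)) :
    ∑ y, predictObs κ pr o y = ∑ z, predict κ pr o z := by
  have h := sum_predict_mul (κ := κ) (pr := pr) o fun _ => 1
  simpa using h.symm

lemma sum_predictObs_le_one (hκ1 : ∀ c, ∑ z, κ c z = 1) (o : List (X ⊕ Z)) :
    ∑ y, predictObs κ pr o y ≤ 1 := by
  rw [sum_predictObs, sum_predict hκ1]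
  exact sum_belief_le_one o

/-- The tower property: the belief is the conditional law of the present state. -/
lemma sum_flagWeight_belief (hκ : ∀ c z, 0 ≤ κ c z) (n : ℕ) (φ : List (X ⊕ Z) → Option Z → ℝ) :
    ∑ h ∈ words (Bool × Z) n, flagWeight κ w h * φ (h.map (mask pr)) (lastState h) =
      ∑ h ∈ words (Bool × Z) n, flagWeight κ w h *
        ∑ c, belief κ pr (h.map (mask pr)) c * φ (h.map (mask pr)) c := by
  classical
  induction n generalizing φ with
  | zero => simp [belief, lastState]
  | succ n ih =>
    rw [sum_flagWeight_succ, sum_flagWeight_succ]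
    simp only [mul_add, Finset.sum_add_distrib]
    congr 1
    · refine Finset.sum_congr rfl fun h _ => ?_
      simp [mask, belief, lastState]
    · have hl (y : Bool × Z) (h : List (Bool × Z)) : lastState (y :: h) = some y.2 := rfl
      have hm (x : Z) (h : List (Bool × Z)) :
          ((false, x) :: h).map (mask pr) = Sum.inl (pr x) :: h.map (mask pr) := rfl
      simp only [hl, hm]
      -- Both sides become functions of the previous observations and state once the next unobserved
      -- step is averaged out, so the induction hypothesis applies to each; Bayes' rule then
      -- identifies them.
      have h1 := ih fun o c => ∑ x, κ c x * φ (Sum.inl (pr x) :: o) (some x)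
      have h2 := ih fun o c => ∑ x, κ c x *
        ∑ c', belief κ pr (Sum.inl (pr x) :: o) c' * φ (Sum.inl (pr x) :: o) c'
      simp only [mul_left_comm _ (w false)]
      rw [← Finset.mul_sum, ← Finset.mul_sum]
      congr 1
      refine h1.trans (Eq.trans ?_ h2.symm)
      refine Finset.sum_congr rfl fun h _ => ?_
      congr 1
      rw [sum_belief_mul_sum, sum_belief_mul_sum,
        sum_predict_mul (h.map (mask pr)) fun y =>
          ∑ c', belief κ pr (Sum.inl y :: h.map (mask pr)) c' *
            φ (Sum.inl y :: h.map (mask pr)) c']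
      simp only [Fintype.sum_option, Finset.mul_sum, mul_add, ← mul_assoc, predictObs_mul_belief hκ]
      have h0 (y : X) (o : List (X ⊕ Z)) : belief κ pr (Sum.inl y :: o) none = 0 := rfl
      simp only [h0, mul_zero, zero_mul, zero_add, ite_mul]
      rw [Finset.sum_comm]
      simp

/-- Observing more makes the prediction better: Gibbs' inequality for the predictions from all
observations and from those without the full observations. -/
lemma sum_flagWeight_log_predictObs_le (hκ : ∀ c z, 0 ≤ κ c z) (hκ1 : ∀ c, ∑ z, κ c z = 1)
    (hw : ∀ b, 0 ≤ w b) (hw1 : w true + w false = 1) (n : ℕ) :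
    ∑ h ∈ words (Bool × Z) n, flagWeight κ w h * ∑ x, κ (lastState h) x *
        Real.log (predictObs κ pr (blind pr (h.map Prod.snd)) (pr x)) ≤
      ∑ h ∈ words (Bool × Z) n, flagWeight κ w h * ∑ x, κ (lastState h) x *
        Real.log (predictObs κ pr (h.map (mask pr)) (pr x)) := by
  set f : X ⊕ Z → X ⊕ Z := Sum.elim Sum.inl fun z => Sum.inl (pr z) with hf
  -- The blind observations are a function `f` of the masked ones, so by the tower property the next
  -- image may be drawn from the masked prediction. This cancels the denominator and leaves the
  -- total mass of the blind prediction.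
  have hratio : ∑ h ∈ words (Bool × Z) n, flagWeight κ w h * ∑ x, κ (lastState h) x *
      (predictObs κ pr (blind pr (h.map Prod.snd)) (pr x) /
        predictObs κ pr (h.map (mask pr)) (pr x)) ≤ 1 := by
    simp only [blind_eq_map_map_mask, ← hf]
    rw [sum_flagWeight_belief hκ n fun o c => ∑ x, κ c x *
      (predictObs κ pr (o.map f) (pr x) / predictObs κ pr o (pr x)),
      ← sum_flagWeight hκ1 hw1 (n := n)]
    refine Finset.sum_le_sum fun h _ => ?_
    refine mul_le_of_le_one_right (flagWeight_nonneg hκ hw h) ?_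
    rw [sum_belief_mul_sum, sum_predict_mul (h.map (mask pr)) fun y =>
      predictObs κ pr ((h.map (mask pr)).map f) y / predictObs κ pr (h.map (mask pr)) y]
    refine le_trans (Finset.sum_le_sum fun y _ => ?_)
      (sum_predictObs_le_one (pr := pr) hκ1 ((h.map (mask pr)).map f))
    rcases eq_or_ne (predictObs κ pr (h.map (mask pr)) y) 0 with h0 | h0
    · rw [h0, zero_mul]
      exact predictObs_nonneg hκ _ _
    · rw [mul_div_cancel₀ _ h0]
  have hone : ∑ h ∈ words (Bool × Z) n, flagWeight κ w h * ∑ x, κ (lastState h) x * 1 = 1 := by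
    simp only [mul_one, hκ1, sum_flagWeight hκ1 hw1]
  rw [← sub_nonpos]
  refine le_trans (le_of_eq_of_le ?_ (b := ∑ h ∈ words (Bool × Z) n, flagWeight κ w h *
    ∑ x, κ (lastState h) x * (Real.log (predictObs κ pr (blind pr (h.map Prod.snd)) (pr x)) -
      Real.log (predictObs κ pr (h.map (mask pr)) (pr x)))) ?_) (sub_nonpos.2 hratio)
  · simp only [mul_sub, Finset.sum_sub_distrib]
  rw [← hone, ← Finset.sum_sub_distrib]
  refine Finset.sum_le_sum fun h _ => ?_
  rcases eq_or_ne (flagWeight κ w h) 0 with h0 | h0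
  · simp [h0]
  rw [← mul_sub, ← Finset.sum_sub_distrib]
  refine mul_le_mul_of_nonneg_left (Finset.sum_le_sum fun x _ => ?_) (flagWeight_nonneg hκ hw h)
  rcases eq_or_ne (κ (lastState h) x) 0 with hx | hx
  · simp [hx]
  rw [← mul_sub]
  refine mul_le_mul_of_nonneg_left ?_ (hκ _ x)
  have hpath := pathWeight_ne_zero_of_flagWeight h0
  have h1 := predictObs_pos (pr := pr) hκ hpath hx
  have h2 := predictObs_blind_pos (pr := pr) hκ hpath hx
  rw [← Real.log_div h2.ne' h1.ne']
  -- The bound `log u ≤ u - 1`, applied to the ratio whose mean is at most `1`.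
  exact Real.log_le_sub_one_of_pos (div_pos h2 h1)

open Classical in
/-- The law of the observed word, when no state is observed fully. -/
lemma sum_pathWeight_map_eq (hκ : ∀ c z, 0 ≤ κ c z) (o : List X) :
    ∑ h ∈ words Z o.length, (if h.map pr = o then pathWeight κ h else 0) =
      weight (fun o y => predictObs κ pr (o.map Sum.inl) y) o := by
  -- With this choice of flags no state is ever fully observed, so on words of nonzero weight masked
  -- and blind observations coincide and the tower property becomes available for unflagged words.
  set w : Bool → ℝ := fun b => if b then 0 else 1 with hw
  have hw1 : w true + w false = 1 := by simp [hw]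
  have hflag : ∀ h : List (Bool × Z), flagWeight κ w h ≠ 0 →
      h.map (mask pr) = blind pr (h.map Prod.snd) := by
    intro h
    induction h with
    | nil => intro; rfl
    | cons y h ih =>
      obtain ⟨b, x⟩ := y
      intro hh
      simp only [flagWeight, weight, ne_eq, mul_eq_zero, not_or] at hh
      cases b
      · simp only [List.map_cons, ih hh.1]
        rfl
      · exact absurd rfl hh.2.1
  induction o with
  | nil => simp only [List.length_nil, sum_words_zero, List.map_nil, if_true, pathWeight, weight]
  | cons y o ih =>
    rw [weight, ← ih, List.length_cons, sum_words_succ, Finset.sum_mul]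
    have h1 (h : List Z) : ∑ x, (if (x :: h).map pr = y :: o then pathWeight κ (x :: h) else 0) =
        pathWeight κ h * if h.map pr = o then ∑ x, κ h.head? x * (if pr x = y then 1 else 0)
          else 0 := by
      simp only [List.map_cons, List.cons.injEq, pathWeight, weight]
      by_cases hh : h.map pr = o
      · simp [hh, Finset.mul_sum]
      · simp [hh]
    simp only [h1, ite_mul, zero_mul]
    rw [← sum_flagWeight_map_snd hw1 o.length fun h => if h.map pr = o then
      ∑ x, κ h.head? x * (if pr x = y then 1 else 0) else 0]
    have h2 := sum_flagWeight_map_snd (κ := κ) hw1 o.length fun h =>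
      if h.map pr = o then predictObs κ pr (o.map Sum.inl) y else 0
    simp only [mul_ite, mul_zero] at h2
    rw [← h2]
    have hdemask (h : List (Bool × Z)) :
        (h.map (mask pr)).map (Sum.elim id pr) = (h.map Prod.snd).map pr := by
      simp only [List.map_map]
      refine List.map_congr_left fun y _ => ?_
      rcases y with ⟨_ | _, x⟩ <;> rfl
    -- Replaces the true last state by its conditional law, which turns the one-step weight into
    -- `predictObs`.
    have h3 := sum_flagWeight_belief (w := w) (pr := pr) hκ o.length fun o' c =>
      if o'.map (Sum.elim id pr) = o then ∑ x, κ c x * (if pr x = y then 1 else 0) else 0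
    simp only [hdemask, lastState] at h3
    rw [h3]
    refine Finset.sum_congr rfl fun h _ => ?_
    rcases eq_or_ne (flagWeight κ w h) 0 with h0 | h0
    · simp [h0]
    split_ifs with hh
    · rw [sum_belief_mul_sum, hflag h h0]
      have hb : blind pr (h.map Prod.snd) = o.map Sum.inl := by
        rw [← hh, blind, List.map_map, List.map_map, List.map_map]
        rfl
      rw [hb]
      simp [predictObs]
    · simp

end Filter

/-! ### The divergence bound -/

/-- The Bretagnolle-Huber inequality for finite sums. -/
lemma sum_mul_sub_sum_mul_le_sqrt {α : Type*} {s : Finset α} {p k l φ : α → ℝ} {D : ℝ}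
    (hp : ∀ a, 0 ≤ p a) (hk : ∀ a, 0 ≤ k a) (hp1 : ∑ a ∈ s, p a = 1) (hk1 : ∑ a ∈ s, k a ≤ 1)
    (hpk : ∀ a, p a ≠ 0 → k a = p a * Real.exp (-l a)) (hD : ∑ a ∈ s, p a * l a ≤ D)
    (hφ : ∀ a, φ a ∈ Set.Icc (0 : ℝ) 1) :
    ∑ a ∈ s, p a * φ a - ∑ a ∈ s, k a * φ a ≤ √(1 - Real.exp (-D)) := by
  set m := ∑ a ∈ s, min (p a) (k a) with hm
  have hle : ∑ a ∈ s, p a * φ a - ∑ a ∈ s, k a * φ a ≤ 1 - m := by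
    rw [← hp1, hm, ← Finset.sum_sub_distrib, ← Finset.sum_sub_distrib]
    refine Finset.sum_le_sum fun a _ => ?_
    have h1 := min_le_left (p a) (k a)
    have h2 := min_le_right (p a) (k a)
    nlinarith [(hφ a).1, (hφ a).2, mul_nonneg (sub_nonneg.2 h1) (sub_nonneg.2 (hφ a).2),
      mul_nonneg (sub_nonneg.2 h2) (hφ a).1]
  -- Minimum and maximum add up to `p a + k a`, and both total masses are at most `1`.
  have hmax : ∑ a ∈ s, max (p a) (k a) ≤ 2 - m := by
    have : ∑ a ∈ s, max (p a) (k a) + m = ∑ a ∈ s, p a + ∑ a ∈ s, k a := by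
      rw [hm, ← Finset.sum_add_distrib, ← Finset.sum_add_distrib]
      exact Finset.sum_congr rfl fun a _ => max_add_min _ _
    linarith
  have hmin0 : 0 ≤ m := Finset.sum_nonneg fun a _ => le_min (hp a) (hk a)
  -- The right side is the Bhattacharyya coefficient `∑ √(p k)`; by Jensen's inequality it is at
  -- least `exp` of minus half the divergence.
  have hbc : Real.exp (-D / 2) ≤ ∑ a ∈ s, √(min (p a) (k a)) * √(max (p a) (k a)) := by
    calc Real.exp (-D / 2) ≤ Real.exp (∑ a ∈ s, p a * (-l a / 2)) := by
          rw [Real.exp_le_exp]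
          have : ∑ a ∈ s, p a * (-l a / 2) = -(∑ a ∈ s, p a * l a) / 2 := by
            rw [← Finset.sum_neg_distrib, Finset.sum_div]
            exact Finset.sum_congr rfl fun a _ => by ring
          linarith
      _ ≤ ∑ a ∈ s, p a * Real.exp (-l a / 2) := by
          have := convexOn_exp.map_sum_le (t := s) (w := p) (p := fun a => -l a / 2)
            (fun a _ => hp a) hp1 fun a _ => Set.mem_univ _
          simpa only [smul_eq_mul] using this
      _ ≤ _ := by
          refine Finset.sum_le_sum fun a _ => ?_
          rcases eq_or_ne (p a) 0 with h0 | h0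
          · rw [h0, zero_mul]
            positivity
          · rw [← Real.sqrt_mul (le_min (hp a) (hk a)), min_mul_max, hpk a h0]
            refine Real.le_sqrt_of_sq_le (le_of_eq ?_)
            have : Real.exp (-l a) = Real.exp (-l a / 2) ^ 2 := by
              rw [← Real.exp_nat_mul]
              congr 1
              push_cast
              ring
            rw [this]
            ring
  have hcs := Finset.sum_mul_sq_le_sq_mul_sq s (fun a => √(min (p a) (k a)))
    fun a => √(max (p a) (k a))
  have hs1 : ∑ a ∈ s, √(min (p a) (k a)) ^ 2 = m :=
    Finset.sum_congr rfl fun a _ => Real.sq_sqrt (le_min (hp a) (hk a))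
  have hs2 : ∑ a ∈ s, √(max (p a) (k a)) ^ 2 = ∑ a ∈ s, max (p a) (k a) :=
    Finset.sum_congr rfl fun a _ => Real.sq_sqrt ((hp a).trans (le_max_left _ _))
  rw [hs1, hs2] at hcs
  -- Cauchy-Schwarz; since `m * (2 - m) = 1 - (1 - m) ^ 2`, this bounds the total variation `1 - m`.
  have hexp : Real.exp (-D) ≤ m * (2 - m) := by
    have : Real.exp (-D) = Real.exp (-D / 2) ^ 2 := by
      rw [← Real.exp_nat_mul]
      congr 1
      push_cast
      ring
    rw [this]
    exact (pow_le_pow_left₀ (Real.exp_pos _).le hbc 2).trans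
      (hcs.trans (mul_le_mul_of_nonneg_left hmax hmin0))
  refine hle.trans (Real.le_sqrt_of_sq_le ?_)
  linarith [show (1 - m) ^ 2 = 1 - m * (2 - m) by ring]

/-! ### Divergence of the flagged path laws -/

section Observations

variable {ι : Type*} [Fintype ι] {Z : Type*} [Fintype Z] {X : ι → Type*}

/-- The conditional weight of the next flagged state given the previous ones if, without
communication, the agents move independently according to their predictions. -/
def obsStep (κ : Option Z → Z → ℝ) (pr : ∀ i, Z → X i) (w : Bool → ℝ) (h : List (Bool × Z))
    (y : Bool × Z) : ℝ :=
  w y.1 * if y.1 then κ (lastState h) y.2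
    else ∏ i, predictObs κ (pr i) (h.map (mask (pr i))) (pr i y.2)

/-- The weight of a word of flagged states if, without communication, the agents move
independently according to their predictions. -/
def obsWeight (κ : Option Z → Z → ℝ) (pr : ∀ i, Z → X i) (w : Bool → ℝ) :
    List (Bool × Z) → ℝ := weight (obsStep κ pr w)

/-- The weight of a word of states under the product of the laws of the agents' paths. -/
def prodWeight (κ : Option Z → Z → ℝ) (pr : ∀ i, Z → X i) : List Z → ℝ :=
  weight fun h x => ∏ i, predictObs κ (pr i) (blind (pr i) h) (pr i x)

/-- The logarithm of the ratio of `flagWeight` and `obsWeight`. -/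
def logRatio (κ : Option Z → Z → ℝ) (pr : ∀ i, Z → X i) : List (Bool × Z) → ℝ
  | [] => 0
  | y :: h => logRatio κ pr h + if y.1 then 0 else Real.log (κ (lastState h) y.2) -
      ∑ i, Real.log (predictObs κ (pr i) (h.map (mask (pr i))) (pr i y.2))

/-- The logarithm of the ratio of `pathWeight` and `prodWeight`. -/
def prodLogRatio (κ : Option Z → Z → ℝ) (pr : ∀ i, Z → X i) : List Z → ℝ
  | [] => 0
  | x :: h => prodLogRatio κ pr h + (Real.log (κ h.head? x) -
      ∑ i, Real.log (predictObs κ (pr i) (blind (pr i) h) (pr i x)))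

variable {κ : Option Z → Z → ℝ} {pr : ∀ i, Z → X i} {w : Bool → ℝ}

lemma mul_exp_neg_log_sub_sum {t : ℝ} {r : ι → ℝ} (ht : 0 < t) (hr : ∀ i, 0 < r i) :
    t * Real.exp (-(Real.log t - ∑ i, Real.log (r i))) = ∏ i, r i := by
  rw [neg_sub, Real.exp_sub, Real.exp_log ht, Real.exp_sum, mul_div_cancel₀ _ ht.ne']
  exact Finset.prod_congr rfl fun i _ => Real.exp_log (hr i)

lemma obsWeight_eq (hκ : ∀ c z, 0 ≤ κ c z) {h : List (Bool × Z)}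
    (hh : pathWeight κ (h.map Prod.snd) ≠ 0) :
    obsWeight κ pr w h = flagWeight κ w h * Real.exp (-logRatio κ pr h) := by
  induction h with
  | nil => simp [obsWeight, flagWeight, weight, logRatio]
  | cons y h ih =>
    have hh' := hh
    simp only [List.map_cons, pathWeight, weight, ne_eq, mul_eq_zero, not_or] at hh'
    have ih' := ih hh'.1
    simp only [obsWeight, flagWeight, weight, logRatio] at ih' ⊢
    rw [ih', neg_add, Real.exp_add, obsStep]
    obtain ⟨b, x⟩ := y
    cases b
    · have h1 := mul_exp_neg_log_sub_sum (ι := ι) (lt_of_le_of_ne (hκ (lastState h) x)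
        (Ne.symm hh'.2)) fun i => predictObs_pos (pr := pr i) hκ hh'.1 hh'.2
      simp only [Bool.false_eq_true, if_false]
      rw [← h1]
      ring
    · simp only [if_true, neg_zero, Real.exp_zero]
      ring

lemma prodWeight_eq (hκ : ∀ c z, 0 ≤ κ c z) {h : List Z} (hh : pathWeight κ h ≠ 0) :
    prodWeight κ pr h = pathWeight κ h * Real.exp (-prodLogRatio κ pr h) := by
  induction h with
  | nil => simp [prodWeight, pathWeight, weight, prodLogRatio]
  | cons x h ih =>
    have hh' := hh
    simp only [pathWeight, weight, ne_eq, mul_eq_zero, not_or] at hh'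
    have ih' := ih hh'.1
    simp only [prodWeight, pathWeight, weight, prodLogRatio] at ih' ⊢
    rw [ih', neg_add, Real.exp_add]
    have h1 := mul_exp_neg_log_sub_sum (ι := ι) (lt_of_le_of_ne (hκ h.head? x)
      (Ne.symm hh'.2)) fun i => predictObs_blind_pos (pr := pr i) hκ hh'.1 hh'.2
    rw [← h1]
    ring

lemma obsWeight_nonneg (hκ : ∀ c z, 0 ≤ κ c z) (hw : ∀ b, 0 ≤ w b) (h : List (Bool × Z)) :
    0 ≤ obsWeight κ pr w h := by
  refine weight_nonneg (fun h y => mul_nonneg (hw _) ?_) h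
  split_ifs
  · exact hκ _ _
  · exact Finset.prod_nonneg fun i _ => predictObs_nonneg hκ _ _

variable [∀ i, Fintype (X i)]

/-- The chain rule for the divergence. A step adds to the log ratio only when its flag is down,
which is independent of the past and of the next state; hence the factor `w false`. -/
lemma sum_logRatio_le (hκ : ∀ c z, 0 ≤ κ c z) (hκ1 : ∀ c, ∑ z, κ c z = 1) (hw : ∀ b, 0 ≤ w b)
    (hw1 : w true + w false = 1) (n : ℕ) :
    ∑ h ∈ words (Bool × Z) n, flagWeight κ w h * logRatio κ pr h ≤
      w false * ∑ h ∈ words Z n, pathWeight κ h * prodLogRatio κ pr h := by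
  rw [← sum_flagWeight_map_snd hw1]
  induction n with
  | zero => simp [logRatio, prodLogRatio]
  | succ n ih =>
    have h1 : ∑ h ∈ words (Bool × Z) (n + 1), flagWeight κ w h * logRatio κ pr h =
        ∑ h ∈ words (Bool × Z) n, flagWeight κ w h * logRatio κ pr h +
        w false * (∑ h ∈ words (Bool × Z) n, flagWeight κ w h *
            ∑ x, κ (lastState h) x * Real.log (κ (lastState h) x) -
          ∑ i, ∑ h ∈ words (Bool × Z) n, flagWeight κ w h * ∑ x, κ (lastState h) x *
            Real.log (predictObs κ (pr i) (h.map (mask (pr i))) (pr i x))) := by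
      rw [sum_flagWeight_succ, Finset.sum_comm, ← Finset.sum_sub_distrib, Finset.mul_sum,
        ← Finset.sum_add_distrib]
      refine Finset.sum_congr rfl fun h _ => ?_
      simp only [logRatio, if_true, Bool.false_eq_true, if_false, add_zero, mul_add, mul_sub,
        Finset.sum_add_distrib, Finset.sum_sub_distrib, ← Finset.sum_mul, hκ1, one_mul]
      rw [← Finset.mul_sum]
      have h2 : ∑ i, ∑ x, κ (lastState h) x *
          Real.log (predictObs κ (pr i) (h.map (mask (pr i))) (pr i x)) =
          ∑ x, κ (lastState h) x *
            ∑ i, Real.log (predictObs κ (pr i) (h.map (mask (pr i))) (pr i x)) := by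
        rw [Finset.sum_comm]
        simp only [Finset.mul_sum]
      rw [h2]
      linear_combination (flagWeight κ w h * logRatio κ pr h) * hw1
    have h1' : ∑ h ∈ words (Bool × Z) (n + 1),
          flagWeight κ w h * prodLogRatio κ pr (h.map Prod.snd) =
        ∑ h ∈ words (Bool × Z) n, flagWeight κ w h * prodLogRatio κ pr (h.map Prod.snd) +
        (∑ h ∈ words (Bool × Z) n, flagWeight κ w h *
            ∑ x, κ (lastState h) x * Real.log (κ (lastState h) x) -
          ∑ i, ∑ h ∈ words (Bool × Z) n, flagWeight κ w h * ∑ x, κ (lastState h) x *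
            Real.log (predictObs κ (pr i) (blind (pr i) (h.map Prod.snd)) (pr i x))) := by
      rw [sum_flagWeight_succ, Finset.sum_comm, ← Finset.sum_sub_distrib,
        ← Finset.sum_add_distrib]
      refine Finset.sum_congr rfl fun h _ => ?_
      simp only [List.map_cons, prodLogRatio, one_mul, mul_add, mul_sub,
        Finset.sum_add_distrib, Finset.sum_sub_distrib, ← Finset.sum_mul, hκ1]
      rw [← Finset.mul_sum]
      have h2 : ∑ i, ∑ x, κ (lastState h) x *
          Real.log (predictObs κ (pr i) (blind (pr i) (h.map Prod.snd)) (pr i x)) =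
          ∑ x, κ (lastState h) x *
            ∑ i, Real.log (predictObs κ (pr i) (blind (pr i) (h.map Prod.snd)) (pr i x)) := by
        rw [Finset.sum_comm]
        simp only [Finset.mul_sum]
      rw [h2, show (h.map Prod.snd).head? = lastState h from rfl]
      linear_combination (flagWeight κ w h * (prodLogRatio κ pr (h.map Prod.snd) +
        ∑ x, κ (lastState h) x * Real.log (κ (lastState h) x) -
        ∑ x, κ (lastState h) x * ∑ i, Real.log
          (predictObs κ (pr i) (blind (pr i) (h.map Prod.snd)) (pr i x)))) * hw1
    rw [h1, h1', mul_add]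
    -- The two increments share the term with `log κ`; they differ only in the log scores of the
    -- agents' predictions, masked against blind.
    refine add_le_add ih (mul_le_mul_of_nonneg_left (sub_le_sub_left ?_ _) (hw false))
    exact Finset.sum_le_sum fun i _ => sum_flagWeight_log_predictObs_le hκ hκ1 hw hw1 n

end Observations

/-! ### The law of the observed execution with intermittent communication -/

section HiddenChain

variable {C Y : Type*} [Fintype C]

open Classical in
/-- The weight of the words that are mapped to a given word by `obs` and have a given last
letter. -/
def jointWeight (κ : Option C → C → ℝ) (obs : C → Y) : List Y → Option C → ℝ
  | [], c => if c = none then 1 else 0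
  | _ :: _, none => 0
  | y :: h, some c' => if obs c' = y then ∑ c, jointWeight κ obs h c * κ c c' else 0

/-- The forward recursion for a hidden Markov chain: keeping the last hidden state beside the
observed word closes the recursion. -/
lemma sum_pathWeight_mul_map [Fintype Y] (κ : Option C → C → ℝ) (obs : C → Y) (n : ℕ)
    (F : List Y → Option C → ℝ) :
    ∑ g ∈ words C n, pathWeight κ g * F (g.map obs) g.head? =
      ∑ h ∈ words Y n, ∑ c, jointWeight κ obs h c * F h c := by
  classical
  induction n generalizing F with
  | zero => simp [pathWeight, weight, jointWeight]
  | succ n ih =>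
    rw [sum_words_succ, sum_words_succ]
    have h1 := ih fun h c => ∑ c', κ c c' * F (obs c' :: h) (some c')
    simp only [Finset.mul_sum, ← mul_assoc] at h1
    refine h1.trans (Finset.sum_congr rfl fun h _ => ?_)
    simp only [Fintype.sum_option (fun c => jointWeight κ obs (_ :: h) c * _)]
    have h0 (y : Y) : jointWeight κ obs (y :: h) none = 0 := rfl
    simp only [h0, zero_mul, zero_add]
    simp only [jointWeight, ite_mul, zero_mul]
    rw [Finset.sum_comm, Finset.sum_comm (γ := Y)]
    refine Finset.sum_congr rfl fun c' _ => ?_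
    simp [add_mul, Finset.sum_mul]

end HiddenChain

/-! ### Configurations as conditionally independent copies of the full chain -/

section IntermittentChain

variable {ι : Type*} {S A : ι → Type*}

/-- The state and the action of an agent. -/
def agentProj (i : ι) (z : Joint S × Joint A) : S i × A i := (z.1 i, z.2 i)

/-- What is observed of a configuration: the flag, the true joint state and the executed joint
action. -/
def observe (c : Config S A) : Bool × (Joint S × Joint A) := (c.1, actual c)

lemma actual_eq_iff (c : Config S A) (z : Joint S × Joint A) :
    actual c = z ↔ ∀ i, agentProj i (c.2 i) = agentProj i z := by
  simp only [actual, agentProj, Prod.ext_iff, funext_iff, forall_and]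

lemma imagine_eq_update [DecidableEq ι] (M : ∀ i, MDP (S i) (A i)) (c : Config S A)
    (s' : Joint S) (i : ι) :
    (fun j => if j = i then PMF.pure (s' j) else (M j).trans ((c.2 i).1 j) ((c.2 i).2 j)) =
      Function.update (fun j => (M j).trans ((c.2 i).1 j) ((c.2 i).2 j)) i
        (PMF.pure (s' i)) := by
  funext j
  by_cases h : j = i
  · subst h
    simp
  · simp [h]

variable [Fintype ι] [DecidableEq ι] [∀ i, Fintype (S i)] [∀ i, Fintype (A i)]

lemma piPMF_toReal {X : ι → Type*} [∀ i, Fintype (X i)] (p : ∀ i, PMF (X i)) (x : ∀ i, X i) :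
    (piPMF p x).toReal = ∏ i, (p i (x i)).toReal := by
  rw [piPMF, PMF.ofFintype_apply, ENNReal.toReal_prod]

/-- Drawing the `i`-th coordinate first and then the others around it is an independent draw of all:
the true move of agent `i` and its simulation of the teammates form one joint transition. -/
lemma sum_piPMF_update {X : ι → Type*} [∀ i, Fintype (X i)] (p : ∀ i, PMF (X i)) (i : ι)
    (x : ∀ i, X i) :
    ∑ t, (p i t).toReal * (piPMF (Function.update p i (PMF.pure t)) x).toReal =
      (piPMF p x).toReal := by
  classical
  have h (t : X i) : (piPMF (Function.update p i (PMF.pure t)) x).toReal =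
      (PMF.pure t (x i)).toReal * ∏ j ∈ Finset.univ.erase i, (p j (x j)).toReal := by
    rw [piPMF_toReal, ← Finset.mul_prod_erase _ _ (Finset.mem_univ i), Function.update_self]
    congr 1
    refine Finset.prod_congr rfl fun j hj => ?_
    rw [Function.update_of_ne (Finset.ne_of_mem_erase hj)]
  simp only [h]
  rw [piPMF_toReal, ← Finset.mul_prod_erase _ _ (Finset.mem_univ i),
    Finset.sum_eq_single (x i)]
  · simp
  · intro t _ ht
    simp [PMF.pure_apply, ht.symm]
  · simp

lemma PMF.toReal_eq_sum {X : Type*} [Fintype X] [DecidableEq X] (p : PMF X) (x : X) :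
    (p x).toReal = ∑ y, (p y).toReal * if y = x then 1 else 0 := by
  simp

lemma act_false_toReal (π : Joint S → PMF (Joint A)) (q : unitInterval) (s : Joint S)
    (imagine : ι → PMF (Joint S)) (g : ι → Joint S × Joint A) :
    (act π q s imagine (false, g)).toReal =
      q * ∏ i, ((imagine i).bind (actFull π) (g i)).toReal := by
  classical
  rw [PMF.toReal_eq_sum, act, PMF.sum_bind_mul, sum_commFlip_mul, if_pos rfl,
    if_neg Bool.false_ne_true, PMF.sum_map_mul, PMF.sum_map_mul]
  simp [piPMF_toReal]

open Classical in
lemma act_true_toReal (π : Joint S → PMF (Joint A)) (q : unitInterval) (s : Joint S)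
    (imagine : ι → PMF (Joint S)) (g : ι → Joint S × Joint A) :
    (act π q s imagine (true, g)).toReal =
      (1 - (q : ℝ)) * ∑ z, (actFull π s z).toReal * if (fun _ => z) = g then 1 else 0 := by
  rw [PMF.toReal_eq_sum, act, PMF.sum_bind_mul, sum_commFlip_mul, if_pos rfl,
    if_neg Bool.false_ne_true, PMF.sum_map_mul, PMF.sum_map_mul, actFull, PMF.sum_map_mul]
  simp

variable (M : ∀ i, MDP (S i) (A i)) (π : Joint S → PMF (Joint A)) (q : unitInterval)

/-- The one-step probabilities under full communication, from `none` at the start. -/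
abbrev fullKer : Option (Joint S × Joint A) → Joint S × Joint A → ℝ :=
  optStep (actFull π (initState M)) (fullStep M π)

/-- The one-step probabilities under intermittent communication, from `none` at the start. -/
abbrev intKer : Option (Config S A) → Config S A → ℝ :=
  optStep (intInit M π q) (intStep M π q)

/-- Without communication the agents' copies move independently, each by one step of the full chain
from its own previous value. -/
lemma intKer_false (c : Option (Config S A)) (g : ι → Joint S × Joint A) :
    intKer M π q c (false, g) = q * ∏ i, fullKer M π (c.map fun c => c.2 i) (g i) := by
  rcases c with _ | c
  · change (act π q _ _ (false, g)).toReal = _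
    rw [act_false_toReal]
    simp only [PMF.pure_bind]
    rfl
  · change (intStep M π q c (false, g)).toReal = _
    rw [intStep, PMF.bind_toReal]
    simp only [act_false_toReal, imagine_eq_update]
    simp only [jointTrans, piPMF_toReal]
    simp only [mul_left_comm _ (q : ℝ), ← Finset.mul_sum, ← Finset.prod_mul_distrib]
    congr 1
    -- The factor of agent `i` involves the true next state only through its `i`-th component, so
    -- the sum over joint states is a product of sums.
    have hprod := Fintype.prod_sum (fun i (t : S i) =>
      ((M i).trans ((actual c).1 i) ((actual c).2 i) t).toReal *
        ((piPMF (Function.update (fun j => (M j).trans ((c.2 i).1 j) ((c.2 i).2 j)) i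
          (PMF.pure t))).bind (actFull π) (g i)).toReal)
    rw [← hprod]
    refine Finset.prod_congr rfl fun i _ => ?_
    change _ = ((piPMF fun j => (M j).trans ((c.2 i).1 j) ((c.2 i).2 j)).bind
      (actFull π) (g i)).toReal
    simp only [PMF.bind_toReal, Finset.mul_sum]
    rw [Finset.sum_comm]
    refine Finset.sum_congr rfl fun y _ => ?_
    rw [← sum_piPMF_update _ i, Finset.sum_mul]
    exact Finset.sum_congr rfl fun t _ => (mul_assoc _ _ _).symm

-- With communication all copies jump to one common value, drawn by a full step from the true state
-- and action; the individual beliefs play no role.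
open Classical in
lemma intKer_true (c : Option (Config S A)) (g : ι → Joint S × Joint A) :
    intKer M π q c (true, g) =
      (1 - (q : ℝ)) * ∑ z, fullKer M π (c.map actual) z * if (fun _ => z) = g then 1 else 0 := by
  rcases c with _ | c
  · exact act_true_toReal _ _ _ _ _
  · change (intStep M π q c (true, g)).toReal = _
    rw [intStep, PMF.bind_toReal]
    simp only [act_true_toReal]
    change _ = (1 - (q : ℝ)) * ∑ z, ((jointTrans M (actual c).1 (actual c).2).bind
      (actFull π) z).toReal * _
    rw [PMF.sum_bind_mul, Finset.mul_sum]
    exact Finset.sum_congr rfl fun s' _ => by ring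

/-- The probability that communication is available, or not. -/
def flagProb (b : Bool) : ℝ := if b then 1 - (q : ℝ) else q

lemma flagProb_nonneg (b : Bool) : 0 ≤ flagProb q b := by
  unfold flagProb
  split_ifs
  · exact sub_nonneg.2 q.2.2
  · exact q.2.1

lemma flagProb_add : flagProb q true + flagProb q false = 1 := by
  simp [flagProb]

/-- The belief degenerates only when the latest observed image had predicted weight zero, and then
the observed word has weight zero. -/
lemma sum_belief_eq_one_of_obsWeight_ne_zero {h : List (Bool × (Joint S × Joint A))}
    (hh : obsWeight (fullKer M π) agentProj (flagProb q) h ≠ 0) (i : ι) :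
    ∑ c, belief (fullKer M π) (agentProj i) (h.map (mask (agentProj i))) c = 1 := by
  classical
  rcases h with _ | ⟨⟨_ | _, x⟩, h⟩
  · simp [belief]
  · change ∑ c, belief _ _ (Sum.inl _ :: h.map (mask (agentProj i))) c = 1
    rw [sum_belief_inl, div_self]
    simp only [obsWeight, weight, obsStep, Bool.false_eq_true, if_false, ne_eq, mul_eq_zero,
      not_or, Finset.prod_eq_zero_iff, not_exists, not_and] at hh
    exact hh.2.2 i (Finset.mem_univ i)
  · change ∑ c, belief _ _ (Sum.inr _ :: h.map (mask (agentProj i))) c = 1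
    simp [belief]

lemma map_actual_of_jointWeight_ne_zero {h : List (Bool × (Joint S × Joint A))}
    {c : Option (Config S A)} (hc : jointWeight (intKer M π q) observe h c ≠ 0) :
    c.map actual = lastState h := by
  classical
  rcases h with _ | ⟨y, h⟩ <;> rcases c with _ | c
  · rfl
  · simp [jointWeight] at hc
  · exact absurd rfl hc
  · rw [jointWeight] at hc
    have hy : observe c = y := by
      by_contra hne
      exact hc (if_neg hne)
    rw [← hy]
    rfl

lemma sum_jointWeight_mul_prod_of_cons {y : Bool × (Joint S × Joint A)}
    {h : List (Bool × (Joint S × Joint A))}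
    (hJ : ∀ b g, jointWeight (intKer M π q) observe (y :: h) (some (b, g)) =
      if b = y.1 then obsWeight (fullKer M π) agentProj (flagProb q) (y :: h) *
        ∏ i, belief (fullKer M π) (agentProj i) ((y :: h).map (mask (agentProj i))) (some (g i))
      else 0)
    (f : ι → Option (Joint S × Joint A) → ℝ) :
    ∑ c, jointWeight (intKer M π q) observe (y :: h) c * ∏ i, f i (c.map fun c => c.2 i) =
      obsWeight (fullKer M π) agentProj (flagProb q) (y :: h) *
        ∏ i, ∑ c, belief (fullKer M π) (agentProj i) ((y :: h).map (mask (agentProj i))) c *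
          f i c := by
  classical
  have hnone (i : ι) :
      belief (fullKer M π) (agentProj i) ((y :: h).map (mask (agentProj i))) none = 0 := by
    rcases y with ⟨_ | _, x⟩
    · rfl
    · change belief (fullKer M π) (agentProj i) (Sum.inr _ :: h.map (mask (agentProj i))) none = 0
      simp [belief]
  have h0 : jointWeight (intKer M π q) observe (y :: h) none = 0 := rfl
  simp only [Fintype.sum_option, hnone, h0, zero_mul, zero_add]
  rw [Fintype.prod_sum, Fintype.sum_prod_type, Finset.mul_sum]
  simp only [hJ, Option.map_some, ite_mul, zero_mul, Finset.prod_mul_distrib]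
  rw [Finset.sum_comm]
  simp [mul_assoc]

/-- The inductive step for conditional independence. At a dropout the kernel is a product, so the
product form propagates, and each predicted weight splits by Bayes' rule into the weight of the
observed component and the new belief. At a communication only constant configurations survive,
matching a belief that is a point mass. -/
lemma jointWeight_cons {h : List (Bool × (Joint S × Joint A))}
    (hsum : ∀ f : ι → Option (Joint S × Joint A) → ℝ,
      ∑ c, jointWeight (intKer M π q) observe h c * ∏ i, f i (c.map fun c => c.2 i) =
      obsWeight (fullKer M π) agentProj (flagProb q) h *
        ∏ i, ∑ c, belief (fullKer M π) (agentProj i) (h.map (mask (agentProj i))) c * f i c)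
    (y : Bool × (Joint S × Joint A)) (b : Bool) (g : ι → Joint S × Joint A) :
    jointWeight (intKer M π q) observe (y :: h) (some (b, g)) =
      if b = y.1 then obsWeight (fullKer M π) agentProj (flagProb q) (y :: h) *
        ∏ i, belief (fullKer M π) (agentProj i) ((y :: h).map (mask (agentProj i))) (some (g i))
      else 0 := by
  classical
  have hκ : ∀ c z, 0 ≤ fullKer M π c z := optStep_nonneg _ _
  have hone : ∑ c, jointWeight (intKer M π q) observe h c =
      obsWeight (fullKer M π) agentProj (flagProb q) h := by
    have h1 := hsum fun _ _ => 1
    simp only [Finset.prod_const_one, mul_one] at h1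
    rw [h1]
    rcases eq_or_ne (obsWeight (fullKer M π) agentProj (flagProb q) h) 0 with h0 | h0
    · rw [h0, zero_mul]
    · rw [Finset.prod_eq_one fun i _ => sum_belief_eq_one_of_obsWeight_ne_zero M π q h0 i, mul_one]
  obtain ⟨b', x⟩ := y
  rw [jointWeight]
  by_cases hb : b = b'
  swap
  · rw [if_neg hb, if_neg]
    intro h
    exact hb (congrArg Prod.fst h)
  subst hb
  have hobs : observe (b, g) = (b, x) ↔ ∀ i, agentProj i (g i) = agentProj i x := by
    rw [observe, Prod.mk.injEq, actual_eq_iff]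
    simp
  rw [if_pos rfl]
  simp only [hobs]
  cases b
  · have hbel (i : ι) : predictObs (fullKer M π) (agentProj i) (h.map (mask (agentProj i)))
        (agentProj i x) * belief (fullKer M π) (agentProj i)
          (((false, x) :: h).map (mask (agentProj i))) (some (g i)) =
        if agentProj i (g i) = agentProj i x then
          predict (fullKer M π) (agentProj i) (h.map (mask (agentProj i))) (g i) else 0 := by
      refine (predictObs_mul_belief (pr := agentProj i) hκ (h.map (mask (agentProj i)))
        (agentProj i x) (g i)).trans ?_
      split_ifs <;> rfl
    have hobsW : obsWeight (fullKer M π) agentProj (flagProb q) ((false, x) :: h) =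
        obsWeight (fullKer M π) agentProj (flagProb q) h * (q * ∏ i, predictObs (fullKer M π)
          (agentProj i) (h.map (mask (agentProj i))) (agentProj i x)) := rfl
    rw [hobsW, mul_assoc, mul_assoc, ← Finset.prod_mul_distrib]
    simp only [hbel]
    split_ifs with hall
    · simp only [intKer_false, mul_left_comm _ (q : ℝ)]
      rw [← Finset.mul_sum, hsum fun i c => fullKer M π c (g i)]
      simp only [hall, if_true]
      rfl
    · push Not at hall
      obtain ⟨i, hi⟩ := hall
      rw [Finset.prod_eq_zero (Finset.mem_univ i) (if_neg hi), mul_zero, mul_zero]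
  · have hbel (i : ι) : belief (fullKer M π) (agentProj i)
        (((true, x) :: h).map (mask (agentProj i))) (some (g i)) = if g i = x then 1 else 0 := by
      change belief (fullKer M π) (agentProj i) (Sum.inr x :: h.map (mask (agentProj i)))
        (some (g i)) = _
      simp [belief]
    have hobsW : obsWeight (fullKer M π) agentProj (flagProb q) ((true, x) :: h) =
        obsWeight (fullKer M π) agentProj (flagProb q) h *
          ((1 - (q : ℝ)) * fullKer M π (lastState h) x) := rfl
    simp only [hbel, hobsW]
    by_cases hg : g = fun _ => x
    · subst hg
      simp only [implies_true, if_true, Finset.prod_const_one, mul_one]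
      -- The kernel sees the hidden configuration only through its true part, which the observed
      -- word determines; the hidden configuration therefore sums out.
      rw [← hone, Finset.sum_mul]
      refine Finset.sum_congr rfl fun c _ => ?_
      rcases eq_or_ne (jointWeight (intKer M π q) observe h c) 0 with h0 | h0
      · rw [h0, zero_mul, zero_mul]
      · rw [intKer_true, map_actual_of_jointWeight_ne_zero M π q h0]
        congr 2
        rw [Finset.sum_eq_single x]
        · simp
        · intro z _ hz
          rw [if_neg, mul_zero]
          intro hzx
          exact hz (congrArg (fun g => actual ((true, g) : Config S A)) hzx)
        · simp
    · have hprod : ∏ i, (if g i = x then (1 : ℝ) else 0) = 0 := by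
        obtain ⟨i, hi⟩ := Function.ne_iff.1 hg
        exact Finset.prod_eq_zero (Finset.mem_univ i) (if_neg hi)
      rw [hprod, mul_zero]
      split_ifs with hall
      · refine Finset.sum_eq_zero fun c _ => ?_
        rw [intKer_true, Finset.sum_eq_zero, mul_zero, mul_zero]
        intro z _
        rw [if_neg, mul_zero]
        rintro rfl
        exact hg (by rw [(actual_eq_iff ((true, fun _ => z) : Config S A) x).2 hall |>.symm]; rfl)
      · rfl

/-- Conditional independence of the copies given the observed word, with the beliefs as marginals.
Testing against products also covers the empty word, where the single value `none` stands for the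
start of every copy. -/
lemma sum_jointWeight_mul_prod (h : List (Bool × (Joint S × Joint A)))
    (f : ι → Option (Joint S × Joint A) → ℝ) :
    ∑ c, jointWeight (intKer M π q) observe h c * ∏ i, f i (c.map fun c => c.2 i) =
      obsWeight (fullKer M π) agentProj (flagProb q) h *
        ∏ i, ∑ c, belief (fullKer M π) (agentProj i) (h.map (mask (agentProj i))) c * f i c := by
  classical
  induction h generalizing f with
  | nil => simp [jointWeight, obsWeight, weight, belief]
  | cons y h ih => exact sum_jointWeight_mul_prod_of_cons M π q (jointWeight_cons M π q ih y) f

lemma sum_jointWeight (h : List (Bool × (Joint S × Joint A))) :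
    ∑ c, jointWeight (intKer M π q) observe h c =
      obsWeight (fullKer M π) agentProj (flagProb q) h := by
  have h1 := sum_jointWeight_mul_prod M π q h fun _ _ => 1
  simp only [Finset.prod_const_one, mul_one] at h1
  rw [h1]
  rcases eq_or_ne (obsWeight (fullKer M π) agentProj (flagProb q) h) 0 with h0 | h0
  · rw [h0, zero_mul]
  · rw [Finset.prod_eq_one fun i _ => sum_belief_eq_one_of_obsWeight_ne_zero M π q h0 i, mul_one]

/-- The law of the flags and of the true joint path under intermittent communication. -/
lemma sum_pathWeight_intKer_mul (n : ℕ) (F : List (Bool × (Joint S × Joint A)) → ℝ) :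
    ∑ g ∈ words (Config S A) n, pathWeight (intKer M π q) g * F (g.map observe) =
      ∑ h ∈ words (Bool × (Joint S × Joint A)) n,
        obsWeight (fullKer M π) agentProj (flagProb q) h * F h := by
  rw [sum_pathWeight_mul_map (intKer M π q) observe n fun h _ => F h]
  simp only [← Finset.sum_mul, sum_jointWeight]

end IntermittentChain

/-! ### The bound in terms of the total correlation -/

attribute [local instance] wordsMeasurableSpace

lemma eq_of_map_agentProj_eq {ι : Type*} {S A : ι → Type*} {l l' : List (Joint S × Joint A)}
    (hlen : l.length = l'.length) (h : ∀ i, l.map (agentProj i) = l'.map (agentProj i)) :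
    l = l' := by
  induction l generalizing l' with
  | nil => exact (List.length_eq_zero_iff.1 hlen.symm).symm
  | cons z l ih =>
    cases l' with
    | nil => simp at hlen
    | cons z' l' =>
      simp only [List.map_cons, List.cons.injEq, forall_and] at h
      rw [ih (by simpa using hlen) h.2]
      congr 1
      have h1 := h.1
      simp only [agentProj, Prod.mk.injEq, forall_and] at h1
      exact Prod.ext (funext h1.1) (funext h1.2)

section CorrelationBound

variable {ι : Type*} [Fintype ι] [DecidableEq ι] {S A : ι → Type*}
  [∀ i, Fintype (S i)] [∀ i, Fintype (A i)]
  (M : ∀ i, MDP (S i) (A i)) (π : Joint S → PMF (Joint A)) (T Av : Set (Joint S))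

/-- With `agentLaw_prefixWord`, this identifies `prodWeight` as the product of the marginal laws of
the agents' finite paths. -/
lemma prod_weight_predictObs (h : List (Joint S × Joint A)) :
    ∏ i, weight (fun o y => predictObs (fullKer M π) (agentProj i) (o.map Sum.inl) y)
      (h.map (agentProj i)) = prodWeight (fullKer M π) agentProj h := by
  induction h with
  | nil => simp [weight, prodWeight]
  | cons x h ih =>
    simp only [List.map_cons, weight, Finset.prod_mul_distrib, ih, prodWeight]
    congr 1
    refine Finset.prod_congr rfl fun i _ => ?_
    rw [blind, List.map_map]
    rfl

variable [∀ i, MeasurableSpace (S i)] [∀ i, MeasurableSingletonClass (S i)]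
  [∀ i, MeasurableSpace (A i)] [∀ i, MeasurableSingletonClass (A i)]

lemma agentLaw_prefixWord (i : ι) (o : List (S i × A i)) :
    (agentLaw M π i).real {x | prefixWord o.length x = o} =
      weight (fun o y => predictObs (fullKer M π) (agentProj i) (o.map Sum.inl) y) o := by
  classical
  rw [show {x : ℕ → S i × A i | prefixWord o.length x = o} = prefixWord o.length ⁻¹' {o} from rfl,
    agentLaw, map_measureReal_apply (measurable_agentPath i)
    (measurable_prefixWord o.length (measurableSet_singleton o)),
    ← sum_pathWeight_map_eq (optStep_nonneg _ _)]
  have hset : agentPath i ⁻¹' (prefixWord o.length ⁻¹' {o}) =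
      {ω : JointPath S A | prefixWord o.length ω ∈ {h | h.map (agentProj i) = o}} := by
    ext ω
    simp only [Set.mem_preimage, Set.mem_singleton_iff, Set.mem_ofPred_eq, map_prefixWord]
    rfl
  rw [hset, ← integral_indicator_one (measurableSet_prefixWord _ _)]
  have h1 := integral_prefixWord (actFull π (initState M)) (fullStep M π) o.length
    fun h => if h.map (agentProj i) = o then 1 else 0
  simp only [mul_ite, mul_one, mul_zero] at h1
  refine Eq.trans (integral_congr_ae (Filter.Eventually.of_forall fun ω => ?_))
    (h1.trans (Finset.sum_congr rfl fun h _ => ?_))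
  · simp only [Set.indicator_apply, Set.mem_ofPred_eq, Pi.one_apply]
  · split_ifs <;> rfl

/-- The divergence of the laws of finite paths is at most the total correlation. -/
lemma sum_pathWeight_mul_prodLogRatio_le (hC : totalCorrelation M π ≠ ∞) (n : ℕ) :
    ∑ h ∈ words (Joint S × Joint A) n,
        pathWeight (fullKer M π) h * prodLogRatio (fullKer M π) agentProj h ≤
      (totalCorrelation M π).toReal := by
  have hprob (i : ι) : IsProbabilityMeasure (agentLaw M π i) :=
    Measure.isProbabilityMeasure_map (measurable_agentPath i).aemeasurable
  have hprobT : IsProbabilityMeasure ((fullLaw M π (initState M)).map teamPath) :=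
    Measure.isProbabilityMeasure_map measurable_teamPath.aemeasurable
  set g : (∀ i, ℕ → S i × A i) → List (Joint S × Joint A) :=
    fun x => prefixWord n (teamPathEquiv.symm x) with hg
  have hgm : Measurable g := (measurable_prefixWord n).comp teamPathEquiv.symm.measurable
  set P := ((fullLaw M π (initState M)).map teamPath).map g with hP
  set Q := (Measure.pi fun i => agentLaw M π i).map g with hQ
  have hPp : IsProbabilityMeasure P := Measure.isProbabilityMeasure_map hgm.aemeasurable
  have hQp : IsProbabilityMeasure Q := Measure.isProbabilityMeasure_map hgm.aemeasurable
  have hPeq : P = (fullLaw M π (initState M)).map (prefixWord n) :=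
    Measure.map_map hgm measurable_teamPath
  -- Data processing under truncation to the first `n` letters.
  have hle : InformationTheory.klDiv P Q ≤ totalCorrelation M π :=
    InformationTheory.klDiv_map_le _ _ hgm
  have hne := ne_top_of_le_ne_top hC hle
  obtain ⟨hac, hint⟩ := InformationTheory.klDiv_ne_top_iff.1 hne
  refine le_of_eq_of_le ?_ (ENNReal.toReal_mono hC hle)
  rw [InformationTheory.toReal_klDiv_of_measure_eq hac (by simp)]
  have hintmap : ∫ h, llr P Q h ∂P =
      ∫ ω, llr P Q (prefixWord n ω) ∂fullLaw M π (initState M) := by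
    rw [hPeq, integral_map (measurable_prefixWord n).aemeasurable
      (measurable_from_top.aestronglyMeasurable)]
  rw [hintmap]
  refine Eq.trans ?_ (integral_prefixWord (actFull π (initState M)) (fullStep M π) n
    (llr P Q)).symm
  refine Finset.sum_congr rfl fun h hh => ?_
  have hn : h.length = n := mem_words.1 hh
  change pathWeight (fullKer M π) h * _ = pathWeight (fullKer M π) h * _
  rcases eq_or_ne (pathWeight (fullKer M π) h) 0 with h0 | h0
  · rw [h0, zero_mul, zero_mul]
  congr 1
  have hPh : P.real {h} = pathWeight (fullKer M π) h := by
    rw [hPeq, map_measureReal_apply (measurable_prefixWord n) (measurableSet_singleton h), ← hn]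
    exact chainLaw_prefixWord _ _ h
  have hQh : Q.real {h} = prodWeight (fullKer M π) agentProj h := by
    have hset : g ⁻¹' {h} =
        Set.univ.pi fun i => {x | prefixWord n x = h.map (agentProj i)} := by
      ext x
      have hproj (i : ι) : (g x).map (agentProj i) = prefixWord n (x i) := map_prefixWord _ _ _
      simp only [Set.mem_preimage, Set.mem_singleton_iff, Set.mem_pi, Set.mem_univ,
        forall_true_left, Set.mem_ofPred_eq, ← hproj]
      refine ⟨fun hx i => hx ▸ rfl, fun hx => eq_of_map_agentProj_eq ?_ hx⟩
      rw [hn]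
      exact length_prefixWord _ _
    rw [hQ, map_measureReal_apply hgm (measurableSet_singleton h), hset, measureReal_def,
      Measure.pi_pi, ENNReal.toReal_prod, ← prod_weight_predictObs]
    refine Finset.prod_congr rfl fun i _ => ?_
    rw [← agentLaw_prefixWord, List.length_map, hn]
    rfl
  -- At an atom of positive weight the density is the quotient of the two weights, that is, the
  -- exponential of `prodLogRatio`.
  have hrn := congrArg ENNReal.toReal (rnDeriv_mul_singleton hac h)
  rw [ENNReal.toReal_mul, ← measureReal_def, ← measureReal_def, hPh, hQh,
    prodWeight_eq (optStep_nonneg _ _) h0, mul_left_comm] at hrn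
  have hrn' := mul_left_cancel₀ h0 (hrn.trans (mul_one _).symm)
  rw [Real.exp_neg, ← div_eq_mul_inv, div_eq_one_iff_eq (Real.exp_pos _).ne'] at hrn'
  rw [llr, hrn', Real.log_exp]

variable (q : unitInterval)

/-- Success within `n` letters is a function of the true path alone, so the full and the
intermittent probabilities are expectations of the same `φ` under `flagWeight` and `obsWeight`. -/
lemma real_fullLaw_reachBy_le (n : ℕ) {D : ℝ}
    (hD : q * ∑ h ∈ words (Joint S × Joint A) n,
      pathWeight (fullKer M π) h * prodLogRatio (fullKer M π) agentProj h ≤ D) :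
    (fullLaw M π (initState M)).real (reachBy (Prod.fst ⁻¹' T) (Prod.fst ⁻¹' Av) n) -
      √(1 - Real.exp (-D)) ≤ valueInt M π T Av q := by
  have hκ : ∀ c z, 0 ≤ fullKer M π c z := optStep_nonneg _ _
  have hκ1 : ∀ c, ∑ z, fullKer M π c z = 1 := sum_optStep _ _
  set φ : List (Bool × (Joint S × Joint A)) → ℝ :=
    reachVal {y | y.2.1 ∈ T} {y | y.2.1 ∈ Av} with hφ
  have hfull : (fullLaw M π (initState M)).real
      (reachBy (Prod.fst ⁻¹' T) (Prod.fst ⁻¹' Av) n) =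
      ∑ h ∈ words (Bool × (Joint S × Joint A)) n,
        flagWeight (fullKer M π) (flagProb q) h * φ h := by
    refine (real_reachBy_eq_sum (actFull π (initState M)) (fullStep M π) _ _ n).trans ?_
    refine (sum_flagWeight_map_snd (flagProb_add q) n _).symm.trans ?_
    refine Finset.sum_congr rfl fun h _ => ?_
    rw [reachVal, wordVal_map]
    rfl
  have hint : (chainLaw (intInit M π q) (intStep M π q)).real
      (reachBy {c | (actual c).1 ∈ T} {c | (actual c).1 ∈ Av} n) =
      ∑ h ∈ words (Bool × (Joint S × Joint A)) n,
        obsWeight (fullKer M π) agentProj (flagProb q) h * φ h := by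
    rw [real_reachBy_eq_sum, ← sum_pathWeight_intKer_mul]
    refine Finset.sum_congr rfl fun h _ => ?_
    rw [hφ, reachVal, reachVal, wordVal_map]
    rfl
  have hobs1 : ∑ h ∈ words (Bool × (Joint S × Joint A)) n,
      obsWeight (fullKer M π) agentProj (flagProb q) h ≤ 1 := by
    have h1 := sum_pathWeight_intKer_mul M π q n fun _ => 1
    simp only [mul_one] at h1
    rw [← h1]
    exact (sum_chainWeight (intInit M π q) (intStep M π q) n).le
  have hbh := sum_mul_sub_sum_mul_le_sqrt (s := words (Bool × (Joint S × Joint A)) n)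
    (flagWeight_nonneg hκ (flagProb_nonneg q)) (obsWeight_nonneg (pr := agentProj) hκ
      (flagProb_nonneg q)) (sum_flagWeight hκ1 (flagProb_add q) n) hobs1
    (fun h hh => obsWeight_eq hκ (pathWeight_ne_zero_of_flagWeight hh))
    ((sum_logRatio_le hκ hκ1 (flagProb_nonneg q) (flagProb_add q) n).trans hD)
    (φ := φ) (reachVal_mem_Icc _ _)
  rw [← hfull, ← hint] at hbh
  have hmono : (chainLaw (intInit M π q) (intStep M π q)).real
      (reachBy {c | (actual c).1 ∈ T} {c | (actual c).1 ∈ Av} n) ≤ valueInt M π T Av q := by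
    rw [valueInt_eq]
    exact measureReal_mono (Set.subset_iUnion _ n)
  linarith

theorem valueFull_sub_sqrt_le_valueInt :
    valueFull M π T Av -
      √(1 - (EReal.exp (-(((q : ℝ) : EReal) * (totalCorrelation M π : EReal)))).toReal) ≤
      valueInt M π T Av q := by
  have key {D : ℝ} (hD : ∀ n, q * ∑ h ∈ words (Joint S × Joint A) n,
      pathWeight (fullKer M π) h * prodLogRatio (fullKer M π) agentProj h ≤ D) :
      valueFull M π T Av - √(1 - Real.exp (-D)) ≤ valueInt M π T Av q := by
    have hlim : Filter.Tendsto (fun n => (fullLaw M π (initState M)).real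
        (reachBy (Prod.fst ⁻¹' T) (Prod.fst ⁻¹' Av) n) - √(1 - Real.exp (-D))) Filter.atTop
        (nhds (valueFull M π T Av - √(1 - Real.exp (-D)))) := by
      rw [valueFull, reachAvoid_eq_iUnion]
      exact (tendsto_real_reachBy _ _ _).sub_const _
    exact le_of_tendsto' hlim fun n => real_fullLaw_reachBy_le M π T Av q n (hD n)
  -- The case `q = 0` comes first, because there the product is `0` even for infinite total
  -- correlation.
  rcases q.2.1.eq_or_lt' with hq | hq
  · have h0 := key (D := 0) fun n => by rw [hq, zero_mul]
    rw [hq, EReal.coe_zero, zero_mul]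
    simpa using h0
  by_cases hC : totalCorrelation M π = ∞
  -- Here the square root is `1` and the bound is trivial.
  · rw [hC, EReal.coe_ennreal_top, EReal.coe_mul_top_of_pos hq, EReal.neg_top, EReal.exp_bot]
    have h1 : valueFull M π T Av ≤ 1 := measureReal_le_one
    have h2 : 0 ≤ valueInt M π T Av q := measureReal_nonneg
    simp only [ENNReal.toReal_zero, sub_zero, Real.sqrt_one]
    linarith
  · have h1 := key (D := q * (totalCorrelation M π).toReal) fun n =>
      mul_le_mul_of_nonneg_left (sum_pathWeight_mul_prodLogRatio_le M π hC n) q.2.1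
    rw [← EReal.coe_ennreal_toReal hC, ← EReal.coe_mul, ← EReal.coe_neg, EReal.exp_coe,
      ENNReal.toReal_ofReal (Real.exp_pos _).le]
    exact h1

end CorrelationBound

end

end ReachAvoid

/-! ### The main theorem -/

open ReachAvoid in
theorem mainTheorem3 {ι : Type*} [Fintype ι] [DecidableEq ι] {S A : ι → Type*}
    [∀ i, Fintype (S i)] [∀ i, MeasurableSpace (S i)] [∀ i, MeasurableSingletonClass (S i)]
    [∀ i, Fintype (A i)] [∀ i, MeasurableSpace (A i)] [∀ i, MeasurableSingletonClass (A i)]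
    (M : ∀ i, MDP (S i) (A i)) (π : Joint S → PMF (Joint A)) (T Av : Set (Joint S))
    (q : unitInterval) :
    -- the total correlation is the sum of the entropies minus the joint entropy
    ∑ i, entropy (agentLaw M π i) = totalCorrelation M π + entropy (fullLaw M π (initState M)) ∧
    -- the expected path length is a finite number
    expLen M π T Av ≠ ∞ ∧
    max (valueFull M π T Av -
          √(1 - (EReal.exp (-(((q : ℝ) : EReal) * (totalCorrelation M π : EReal)))).toReal))
        (valueFull M π T Av *
          (1 - (q : ℝ)) ^ ((expLen M π T Av).toReal / valueFull M π T Av)) ≤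
      valueInt M π T Av q :=
  ⟨sum_entropy_agentLaw M π, expLen_ne_top M π T Av,
    max_le (valueFull_sub_sqrt_le_valueInt M π T Av q)
      (valueFull_mul_rpow_le_valueInt M π T Av q)⟩
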